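/- Let $\tilde{\mathcal C},\tilde{\mathcal D}$ be monoidal categories. A $\tilde{\mathcal C}$-$\tilde{\mathcal D}$-biactegory is a category $\mathcal M$ with a left action $\triangleright$ of $\tilde{\mathcal C}$, a right action $\triangleleft$ of $\tilde{\mathcal D}$ (both associative and unital up to coherent natural isomorphism), and a natural isomorphism $l_{c,m,d}: c\triangleright(m\triangleleft d)\to(c\triangleright m)\triangleleft d$, the distributive law, satisfying two pentagons (with the associativity constraints of the two actions) and two triangles (with the unit constraints). A colax biequivariant functor $F:\mathcal M\to\mathcal N$ is a functor with natural morphisms $F(c\triangleright m)\to c\triangleright F(m)$ and $F(m\triangleleft d)\to F(m)\triangleleft d$ that are coherent for the actions and compatible with the distributive laws. The 2-category $\mathrm{Biact}_c(\tilde{\mathcal C},\tilde{\mathcal D})$ has the biactegories as objects, the colax biequivariant functors as 1-cells and the natural transformations commuting with the structure morphisms as 2-cells. Two biactegories are called biequivalent if they are equivalent objects of this 2-category. The distributive law $l$ is the identity if $c\triangleright(m\triangleleft d)=(c\triangleright m)\triangleleft d$ and $l_{c,m,d}$ is the identity morphism, for all $c,m,d$. For a $\tilde{\mathcal C}$-$\tilde{\mathcal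 D}$-biactegory $\mathcal M$ and a $\tilde{\mathcal D}$-$\tilde{\mathcal E}$-biactegory $\mathcal N$, the tensor product $\mathcal M\otimes_{\tilde{\mathcal D}}\mathcal N$ is the pseudocoequalizer in $\mathbf{Cat}$ of $\triangleleft\times\mathcal N,\ \mathcal M\times\triangleright:\mathcal M\times\mathcal D\times\mathcal N\to\mathcal M\times\mathcal N$ taken with coherence. That is, it is a category with a functor $p:\mathcal M\times\mathcal N\to\mathcal M\otimes_{\tilde{\mathcal D}}\mathcal N$ and a natural isomorphism $\sigma_{m,d,n}:p(m\triangleleft d,n)\to p(m,d\triangleright n)$ compatible with the associativity and unit constraints of the two actions of $\tilde{\mathcal D}$. The pair $(p,\sigma)$ is strictly universal: for each category $\mathcal X$, composition with $(p,\sigma)$ is an isomorphism from the category of functors $\mathcal M\otimes_{\tilde{\mathcal D}}\mathcal N\to\mathcal X$ to the category of functors $\mathcal M\times\mathcal N\to\mathcal X$ equipped with such a coherent isomorphism. Its inherited $\tilde{\mathcal C}$-$\tilde{\mathcal E}$-biactegory structure is one for which $p$ is strictly equivariant, $c\triangleright p(m,n)=p(c\triangleright m,n)$ and $p(m,n)\triangleleft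 e=p(m,n\triangleleft e)$, compatibly with the constraints and distributive laws ($\mathcal M\times\mathcal N$ carrying the outer actions and the identity distributive law), and for which $\sigma$ is compatible with the two actions through the distributive laws of $\mathcal M$ and $\mathcal N$. **Proposition.** Let $\tilde{\mathcal G},\tilde{\mathcal G}'$ be monoidal categories and let $\mathcal M$ be a biactegory in $\mathrm{Biact}_c(\tilde{\mathcal G},\tilde{\mathcal G}')$. Regard $\mathcal G$ as a $\tilde{\mathcal G}$-$\tilde{\mathcal G}$-biactegory by its monoidal product. Then the tensor product $\mathcal G\otimes_{\tilde{\mathcal G}}\mathcal M$ exists as a biactegory in $\mathrm{Biact}_c(\tilde{\mathcal G},\tilde{\mathcal G}')$, its distributive law is the identity, and it is biequivalent to $\mathcal M$. In particular, every biactegory is biequivalent to one whose distributive law is the identity. -/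

import Mathlib

open CategoryTheory MonoidalCategory
open scoped MonoidalLeftAction MonoidalRightAction Bicategory

universe v u

/-- `f` is an identity morphism; its source and target are then equal objects. -/
def IsIdentity {A : Type u} [Category.{v} A] {X Y : A} (f : X ⟶ Y) : Prop :=
  ∃ h : X = Y, f = eqToHom h

/-- A distributive law between a left action of `C` and a right action of `D` on the same
category `A`: a natural transformation `c ▷ (a ◁ d) ⟶ (c ▷ a) ◁ d`, subject to two pentagons and
two triangles. -/
@[ext]
structure DistributiveLaw (C : Type u) [Category.{v} C] [MonoidalCategory C]
    (D : Type u) [Category.{v} D] [MonoidalCategory D]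
    (A : Type u) [Category.{v} A] [MonoidalLeftAction C A] [MonoidalRightAction D A] where
  app (c : C) (a : A) (d : D) : c ⊙ₗ (a ⊙ᵣ d) ⟶ (c ⊙ₗ a) ⊙ᵣ d
  naturality {c c' : C} {a a' : A} {d d' : D} (f : c ⟶ c') (g : a ⟶ a') (h : d ⟶ d') :
    (f ⊙ₗₘ (g ⊙ᵣₘ h)) ≫ app c' a' d' = app c a d ≫ ((f ⊙ₗₘ g) ⊙ᵣₘ h)
  left_pentagon (c c' : C) (a : A) (d : D) :
    (αₗ c c' (a ⊙ᵣ d)).hom ≫ c ⊴ₗ (app c' a d) ≫ app c (c' ⊙ₗ a) d =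
      app (c ⊗ c') a d ≫ (αₗ c c' a).hom ⊵ᵣ d
  right_pentagon (c : C) (a : A) (d d' : D) :
    c ⊴ₗ (αᵣ a d d').hom ≫ app c (a ⊙ᵣ d) d' ≫ (app c a d) ⊵ᵣ d' =
      app c a (d ⊗ d') ≫ (αᵣ (c ⊙ₗ a) d d').hom
  left_triangle (a : A) (d : D) :
    app (𝟙_ C) a d ≫ (λₗ[C] a).hom ⊵ᵣ d = (λₗ[C] (a ⊙ᵣ d)).hom
  right_triangle (c : C) (a : A) :
    app c a (𝟙_ D) ≫ (ρᵣ[D] (c ⊙ₗ a)).hom = c ⊴ₗ (ρᵣ[D] a).hom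

/-- A `C`-`D`-biactegory: a category with a left action of `C`, a right action of `D` and an
invertible distributive law between them. -/
structure Biactegory (C : Type u) [Category.{v} C] [MonoidalCategory C]
    (D : Type u) [Category.{v} D] [MonoidalCategory D] where
  carrier : Type u
  [category : Category.{v} carrier]
  [leftAction : MonoidalLeftAction C carrier]
  [rightAction : MonoidalRightAction D carrier]
  law : DistributiveLaw C D carrier
  isIso_law (c : C) (a : carrier) (d : D) : IsIso (law.app c a d)

attribute [instance] Biactegory.category Biactegory.leftAction Biactegory.rightAction

/-- The distributive law of a biactegory is the identity: each component is an identity morphism.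
As the components are natural, the functors `(c, a, d) ↦ c ▷ (a ◁ d)` and
`(c, a, d) ↦ (c ▷ a) ◁ d` then coincide, and the law is the identity transformation. -/
def Biactegory.HasIdentityLaw {C : Type u} [Category.{v} C] [MonoidalCategory C]
    {D : Type u} [Category.{v} D] [MonoidalCategory D] (M : Biactegory.{v, u} C D) : Prop :=
  ∀ (c : C) (a : M.carrier) (d : D), IsIdentity (M.law.app c a d)

section BiequivariantFunctors

variable {C : Type u} [Category.{v} C] [MonoidalCategory C]
  {D : Type u} [Category.{v} D] [MonoidalCategory D]

/-- A colax biequivariant functor `F : M ⥤ N`: coherent natural morphisms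
`F (c ▷ a) ⟶ c ▷ F a` and `F (a ◁ d) ⟶ F a ◁ d`, compatible with the distributive laws. -/
structure ColaxBiequivariantFunctor (M N : Biactegory.{v, u} C D) where
  functor : M.carrier ⥤ N.carrier
  [left : functor.OplaxLeftLinear C]
  [right : functor.OplaxRightLinear D]
  law_comp (c : C) (a : M.carrier) (d : D) :
    Functor.OplaxLeftLinear.δₗ functor c (a ⊙ᵣ d) ≫
        c ⊴ₗ (Functor.OplaxRightLinear.δᵣ functor a d) ≫ N.law.app c (functor.obj a) d =
      functor.map (M.law.app c a d) ≫ Functor.OplaxRightLinear.δᵣ functor (c ⊙ₗ a) d ≫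
        (Functor.OplaxLeftLinear.δₗ functor c a) ⊵ᵣ d

namespace ColaxBiequivariantFunctor

attribute [instance] left right

variable {M N P Q : Biactegory.{v, u} C D}

/-- The coherence `F (c ▷ a) ⟶ c ▷ F a`. -/
abbrev leftCoh (F : ColaxBiequivariantFunctor M N) (c : C) (a : M.carrier) :
    F.functor.obj (c ⊙ₗ a) ⟶ c ⊙ₗ F.functor.obj a :=
  Functor.OplaxLeftLinear.δₗ F.functor c a

/-- The coherence `F (a ◁ d) ⟶ F a ◁ d`. -/
abbrev rightCoh (F : ColaxBiequivariantFunctor M N) (a : M.carrier) (d : D) :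
    F.functor.obj (a ⊙ᵣ d) ⟶ F.functor.obj a ⊙ᵣ d :=
  Functor.OplaxRightLinear.δᵣ F.functor a d

/-- The identity biequivariant functor. -/
def id (M : Biactegory.{v, u} C D) : ColaxBiequivariantFunctor M M where
  functor := 𝟭 M.carrier
  left := { δₗ := fun c a => 𝟙 (c ⊙ₗ a) }
  right := { δᵣ := fun a d => 𝟙 (a ⊙ᵣ d) }
  law_comp c a d := by simp

/-- The composite of two colax biequivariant functors. -/
def comp (F : ColaxBiequivariantFunctor M N) (G : ColaxBiequivariantFunctor N P) :
    ColaxBiequivariantFunctor M P where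
  functor := F.functor ⋙ G.functor
  left :=
    { δₗ := fun c a => G.functor.map (F.leftCoh c a) ≫ G.leftCoh c (F.functor.obj a)
      δₗ_naturality_left := fun f d => by
        simp only [leftCoh, Functor.comp_map, ← G.functor.map_comp_assoc,
          Functor.OplaxLeftLinear.δₗ_naturality_left]
        simp
      δₗ_naturality_right := fun c _ _ f => by
        simp only [leftCoh, Functor.comp_map, ← G.functor.map_comp_assoc,
          Functor.OplaxLeftLinear.δₗ_naturality_right]
        simp
      δₗ_associativity := fun c c' d => by
        simp only [leftCoh, Functor.comp_map, Functor.comp_obj, Category.assoc,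
          Functor.OplaxLeftLinear.δₗ_associativity, MonoidalLeftAction.actionHomRight_comp]
        rw [← G.functor.map_comp_assoc, Functor.OplaxLeftLinear.δₗ_associativity]
        simp
      δₗ_unitality_inv := fun d => by
        simp only [leftCoh, Functor.comp_map, Functor.comp_obj,
          Functor.OplaxLeftLinear.δₗ_unitality_inv, Functor.map_comp, Category.assoc] }
  right :=
    { δᵣ := fun a d => G.functor.map (F.rightCoh a d) ≫ G.rightCoh (F.functor.obj a) d
      δᵣ_naturality_left := fun f d => by
        simp only [rightCoh, Functor.comp_map, ← G.functor.map_comp_assoc,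
          Functor.OplaxRightLinear.δᵣ_naturality_left]
        simp
      δᵣ_naturality_right := fun a _ _ f => by
        simp only [rightCoh, Functor.comp_map, ← G.functor.map_comp_assoc,
          Functor.OplaxRightLinear.δᵣ_naturality_right]
        simp
      δᵣ_associativity := fun a d d' => by
        simp only [rightCoh, Functor.comp_map, Functor.comp_obj, Category.assoc,
          Functor.OplaxRightLinear.δᵣ_associativity, MonoidalRightAction.comp_actionHomLeft]
        rw [← G.functor.map_comp_assoc, Functor.OplaxRightLinear.δᵣ_associativity]
        simp
      δᵣ_unitality_inv := fun d => by
        simp only [rightCoh, Functor.comp_map, Functor.comp_obj,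
          Functor.OplaxRightLinear.δᵣ_unitality_inv, Functor.map_comp, Category.assoc] }
  law_comp c a d := by
    have h1 := G.law_comp c (F.functor.obj a) d
    have h2 := congrArg G.functor.map (F.law_comp c a d)
    simp only [Functor.map_comp] at h2
    simp only [leftCoh, rightCoh, Functor.comp_map, Functor.comp_obj, Category.assoc,
      MonoidalLeftAction.actionHomRight_comp, MonoidalRightAction.comp_actionHomLeft]
    rw [← Functor.OplaxLeftLinear.δₗ_naturality_right_assoc, h1, reassoc_of% h2,
      Functor.OplaxRightLinear.δᵣ_naturality_left_assoc]

end ColaxBiequivariantFunctor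

/-- A natural transformation of colax biequivariant functors: a natural transformation that
commutes with the coherences for both actions. -/
@[ext]
structure BiequivariantNatTrans {M N : Biactegory.{v, u} C D}
    (F G : ColaxBiequivariantFunctor M N) where
  natTrans : F.functor ⟶ G.functor
  left_comm (c : C) (a : M.carrier) :
    natTrans.app (c ⊙ₗ a) ≫ G.leftCoh c a = F.leftCoh c a ≫ c ⊴ₗ (natTrans.app a)
  right_comm (a : M.carrier) (d : D) :
    natTrans.app (a ⊙ᵣ d) ≫ G.rightCoh a d = F.rightCoh a d ≫ (natTrans.app a) ⊵ᵣ d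

namespace ColaxBiequivariantFunctor

/-- Colax biequivariant functors `M → N` and their natural transformations form a category. -/
instance homCategory (M N : Biactegory.{v, u} C D) :
    Category (ColaxBiequivariantFunctor M N) where
  Hom F G := BiequivariantNatTrans F G
  id F := { natTrans := 𝟙 F.functor, left_comm := by simp, right_comm := by simp }
  comp α β :=
    { natTrans := α.natTrans ≫ β.natTrans
      left_comm := fun c a => by
        simp [β.left_comm, reassoc_of% (α.left_comm c a)]
      right_comm := fun a d => by
        simp [β.right_comm, reassoc_of% (α.right_comm a d)] }
  id_comp α := BiequivariantNatTrans.ext (Category.id_comp α.natTrans)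
  comp_id α := BiequivariantNatTrans.ext (Category.comp_id α.natTrans)
  assoc α β γ := BiequivariantNatTrans.ext (Category.assoc α.natTrans β.natTrans γ.natTrans)

variable {M N P Q : Biactegory.{v, u} C D}

@[ext]
theorem hom_ext {F G : ColaxBiequivariantFunctor M N} {α β : F ⟶ G}
    (h : ∀ a, α.natTrans.app a = β.natTrans.app a) : α = β :=
  BiequivariantNatTrans.ext (NatTrans.ext (funext h))

@[simp]
theorem id_app (F : ColaxBiequivariantFunctor M N) (a : M.carrier) :
    (BiequivariantNatTrans.natTrans (𝟙 F)).app a = 𝟙 (F.functor.obj a) := rfl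

@[simp]
theorem comp_app {F G H : ColaxBiequivariantFunctor M N} (α : F ⟶ G) (β : G ⟶ H)
    (a : M.carrier) :
    (α ≫ β).natTrans.app a = α.natTrans.app a ≫ β.natTrans.app a := rfl

/-- A natural isomorphism that commutes with the coherences is an isomorphism of colax
biequivariant functors. -/
def isoOfNatIso {F G : ColaxBiequivariantFunctor M N} (e : F.functor ≅ G.functor)
    (hl : ∀ c a, e.hom.app (c ⊙ₗ a) ≫ G.leftCoh c a = F.leftCoh c a ≫ c ⊴ₗ (e.hom.app a))
    (hr : ∀ a d, e.hom.app (a ⊙ᵣ d) ≫ G.rightCoh a d = F.rightCoh a d ≫ (e.hom.app a) ⊵ᵣ d) :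
    F ≅ G where
  hom := { natTrans := e.hom, left_comm := hl, right_comm := hr }
  inv :=
    { natTrans := e.inv
      left_comm := fun c a => by
        rw [← cancel_epi (e.hom.app (c ⊙ₗ a)), reassoc_of% (hl c a)]
        simp [← MonoidalLeftAction.actionHomRight_comp]
      right_comm := fun a d => by
        rw [← cancel_epi (e.hom.app (a ⊙ᵣ d)), reassoc_of% (hr a d)]
        simp [← MonoidalRightAction.comp_actionHomLeft] }
  hom_inv_id := hom_ext fun a => e.hom_inv_id_app a
  inv_hom_id := hom_ext fun a => e.inv_hom_id_app a

/-- Left whiskering. -/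
def whiskerLeft (F : ColaxBiequivariantFunctor M N) {G H : ColaxBiequivariantFunctor N P}
    (α : G ⟶ H) : F.comp G ⟶ F.comp H where
  natTrans := Functor.whiskerLeft F.functor α.natTrans
  left_comm c a := by
    change α.natTrans.app (F.functor.obj (c ⊙ₗ a)) ≫
        H.functor.map (F.leftCoh c a) ≫ H.leftCoh c (F.functor.obj a) =
      (G.functor.map (F.leftCoh c a) ≫ G.leftCoh c (F.functor.obj a)) ≫
        c ⊴ₗ α.natTrans.app (F.functor.obj a)
    rw [← α.natTrans.naturality_assoc, α.left_comm, Category.assoc]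
  right_comm a d := by
    change α.natTrans.app (F.functor.obj (a ⊙ᵣ d)) ≫
        H.functor.map (F.rightCoh a d) ≫ H.rightCoh (F.functor.obj a) d =
      (G.functor.map (F.rightCoh a d) ≫ G.rightCoh (F.functor.obj a) d) ≫
        α.natTrans.app (F.functor.obj a) ⊵ᵣ d
    rw [← α.natTrans.naturality_assoc, α.right_comm, Category.assoc]

/-- Right whiskering. -/
def whiskerRight {F G : ColaxBiequivariantFunctor M N} (α : F ⟶ G)
    (H : ColaxBiequivariantFunctor N P) : F.comp H ⟶ G.comp H where
  natTrans := Functor.whiskerRight α.natTrans H.functor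
  left_comm c a := by
    change H.functor.map (α.natTrans.app (c ⊙ₗ a)) ≫
        H.functor.map (G.leftCoh c a) ≫ H.leftCoh c (G.functor.obj a) =
      (H.functor.map (F.leftCoh c a) ≫ H.leftCoh c (F.functor.obj a)) ≫
        c ⊴ₗ H.functor.map (α.natTrans.app a)
    rw [← H.functor.map_comp_assoc, α.left_comm, Functor.map_comp, Category.assoc,
      Functor.OplaxLeftLinear.δₗ_naturality_right, Category.assoc]
  right_comm a d := by
    change H.functor.map (α.natTrans.app (a ⊙ᵣ d)) ≫
        H.functor.map (G.rightCoh a d) ≫ H.rightCoh (G.functor.obj a) d =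
      (H.functor.map (F.rightCoh a d) ≫ H.rightCoh (F.functor.obj a) d) ≫
        H.functor.map (α.natTrans.app a) ⊵ᵣ d
    rw [← H.functor.map_comp_assoc, α.right_comm, Functor.map_comp, Category.assoc,
      Functor.OplaxRightLinear.δᵣ_naturality_left, Category.assoc]

/-- The associator. -/
def associator (F : ColaxBiequivariantFunctor M N) (G : ColaxBiequivariantFunctor N P)
    (H : ColaxBiequivariantFunctor P Q) : (F.comp G).comp H ≅ F.comp (G.comp H) :=
  isoOfNatIso (Functor.associator F.functor G.functor H.functor)
    (fun c a => by
      change 𝟙 _ ≫ H.functor.map (G.functor.map (F.leftCoh c a)) ≫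
          H.functor.map (G.leftCoh c (F.functor.obj a)) ≫
            H.leftCoh c (G.functor.obj (F.functor.obj a)) =
        (H.functor.map (G.functor.map (F.leftCoh c a) ≫ G.leftCoh c (F.functor.obj a)) ≫
          H.leftCoh c (G.functor.obj (F.functor.obj a))) ≫ c ⊴ₗ 𝟙 _
      simp)
    (fun a d => by
      change 𝟙 _ ≫ H.functor.map (G.functor.map (F.rightCoh a d)) ≫
          H.functor.map (G.rightCoh (F.functor.obj a) d) ≫
            H.rightCoh (G.functor.obj (F.functor.obj a)) d =
        (H.functor.map (G.functor.map (F.rightCoh a d) ≫ G.rightCoh (F.functor.obj a) d) ≫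
          H.rightCoh (G.functor.obj (F.functor.obj a)) d) ≫ (𝟙 _ : _ ⟶ _) ⊵ᵣ d
      simp)

/-- The left unitor. -/
def leftUnitor (F : ColaxBiequivariantFunctor M N) :
    (ColaxBiequivariantFunctor.id M).comp F ≅ F :=
  isoOfNatIso (Functor.leftUnitor F.functor)
    (fun c a => by
      change 𝟙 _ ≫ F.leftCoh c a = (F.functor.map (𝟙 _) ≫ F.leftCoh c a) ≫ c ⊴ₗ 𝟙 _
      simp)
    (fun a d => by
      change 𝟙 _ ≫ F.rightCoh a d =
        (F.functor.map (𝟙 _) ≫ F.rightCoh a d) ≫ (𝟙 _ : _ ⟶ _) ⊵ᵣ d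
      simp)

/-- The right unitor. -/
def rightUnitor (F : ColaxBiequivariantFunctor M N) :
    F.comp (ColaxBiequivariantFunctor.id N) ≅ F :=
  isoOfNatIso (Functor.rightUnitor F.functor)
    (fun c a => by
      change 𝟙 _ ≫ F.leftCoh c a = (F.leftCoh c a ≫ 𝟙 _) ≫ c ⊴ₗ 𝟙 _
      simp)
    (fun a d => by
      change 𝟙 _ ≫ F.rightCoh a d = (F.rightCoh a d ≫ 𝟙 _) ≫ (𝟙 _ : _ ⟶ _) ⊵ᵣ d
      simp)

end ColaxBiequivariantFunctor

/-- The 2-category `Biact_c(C, D)` of `C`-`D`-biactegories, colax biequivariant functors and their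
natural transformations. -/
instance Biactegory.bicategory : Bicategory (Biactegory.{v, u} C D) where
  Hom M N := ColaxBiequivariantFunctor M N
  id M := ColaxBiequivariantFunctor.id M
  comp F G := ColaxBiequivariantFunctor.comp F G
  homCategory M N := ColaxBiequivariantFunctor.homCategory M N
  whiskerLeft F _ _ α := ColaxBiequivariantFunctor.whiskerLeft F α
  whiskerRight α H := ColaxBiequivariantFunctor.whiskerRight α H
  associator F G H := ColaxBiequivariantFunctor.associator F G H
  leftUnitor F := ColaxBiequivariantFunctor.leftUnitor F
  rightUnitor F := ColaxBiequivariantFunctor.rightUnitor F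
  whiskerLeft_id F G := ColaxBiequivariantFunctor.hom_ext fun a => rfl
  whiskerLeft_comp F _ _ _ α β := ColaxBiequivariantFunctor.hom_ext fun a => rfl
  id_whiskerLeft α := ColaxBiequivariantFunctor.hom_ext fun a =>
    ((Category.id_comp _).trans (Category.comp_id _)).symm
  comp_whiskerLeft F G _ _ α := ColaxBiequivariantFunctor.hom_ext fun a =>
    ((Category.id_comp _).trans (Category.comp_id _)).symm
  id_whiskerRight F G := ColaxBiequivariantFunctor.hom_ext fun a => G.functor.map_id _
  comp_whiskerRight α β H := ColaxBiequivariantFunctor.hom_ext fun a => H.functor.map_comp _ _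
  whiskerRight_id α := ColaxBiequivariantFunctor.hom_ext fun a =>
    ((Category.id_comp _).trans (Category.comp_id _)).symm
  whiskerRight_comp α G H := ColaxBiequivariantFunctor.hom_ext fun a =>
    ((Category.id_comp _).trans (Category.comp_id _)).symm
  whisker_assoc F _ _ α H := ColaxBiequivariantFunctor.hom_ext fun a =>
    ((Category.id_comp _).trans (Category.comp_id _)).symm
  whisker_exchange α β := ColaxBiequivariantFunctor.hom_ext fun a =>
    (β.natTrans.naturality (α.natTrans.app a)).symm
  pentagon F G H K := ColaxBiequivariantFunctor.hom_ext fun a => by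
    change K.functor.map (𝟙 _) ≫ 𝟙 _ ≫ 𝟙 _ = 𝟙 _ ≫ 𝟙 _
    simp
  triangle F G := ColaxBiequivariantFunctor.hom_ext fun a => by
    change 𝟙 _ ≫ 𝟙 _ = G.functor.map (𝟙 _)
    simp

end BiequivariantFunctors

section TensorProduct

/-- A balancing of a functor `F : A × B ⥤ X`, where `D` acts on the right on `A` and on the left on
`B`: a natural isomorphism `F (a ◁ x, b) ≅ F (a, x ▷ b)`, that is, an invertible 2-cell
`F ∘ (◁ × B) ⇒ F ∘ (A × ▷)`, compatible with the associativity and unit constraints of the two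
actions. -/
structure Balancing (D : Type u) [Category.{v} D] [MonoidalCategory D]
    {A : Type u} [Category.{v} A] [MonoidalRightAction D A]
    {B : Type u} [Category.{v} B] [MonoidalLeftAction D B]
    {X : Type u} [Category.{v} X] (F : A × B ⥤ X) where
  iso (a : A) (x : D) (b : B) : F.obj (a ⊙ᵣ x, b) ≅ F.obj (a, x ⊙ₗ b)
  naturality {a a' : A} {x x' : D} {b b' : B} (f : a ⟶ a') (g : x ⟶ x') (h : b ⟶ b') :
    F.map ((f ⊙ᵣₘ g, h) : (a ⊙ᵣ x, b) ⟶ (a' ⊙ᵣ x', b')) ≫ (iso a' x' b').hom =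
      (iso a x b).hom ≫ F.map ((f, g ⊙ₗₘ h) : (a, x ⊙ₗ b) ⟶ (a', x' ⊙ₗ b'))
  associativity (a : A) (x y : D) (b : B) :
    (iso a (x ⊗ y) b).hom ≫
        F.map ((𝟙 a, (αₗ x y b).hom) : (a, (x ⊗ y) ⊙ₗ b) ⟶ (a, x ⊙ₗ (y ⊙ₗ b))) =
      F.map (((αᵣ a x y).hom, 𝟙 b) : (a ⊙ᵣ (x ⊗ y), b) ⟶ ((a ⊙ᵣ x) ⊙ᵣ y, b)) ≫
        (iso (a ⊙ᵣ x) y b).hom ≫ (iso a x (y ⊙ₗ b)).hom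
  unitality (a : A) (b : B) :
    (iso a (𝟙_ D) b).hom ≫
        F.map ((𝟙 a, (λₗ[D] b).hom) : (a, 𝟙_ D ⊙ₗ b) ⟶ (a, b)) =
      F.map (((ρᵣ[D] a).hom, 𝟙 b) : (a ⊙ᵣ 𝟙_ D, b) ⟶ (a, b))

/-- A balanced functor `A × B ⥤ X`: a functor together with a balancing. -/
structure BalancedFunctor (D : Type u) [Category.{v} D] [MonoidalCategory D]
    (A : Type u) [Category.{v} A] [MonoidalRightAction D A]
    (B : Type u) [Category.{v} B] [MonoidalLeftAction D B]
    (X : Type u) [Category.{v} X] where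
  functor : A × B ⥤ X
  bal : Balancing D functor

namespace BalancedFunctor

variable {D : Type u} [Category.{v} D] [MonoidalCategory D]
  {A : Type u} [Category.{v} A] [MonoidalRightAction D A]
  {B : Type u} [Category.{v} B] [MonoidalLeftAction D B]
  {P X : Type u} [Category.{v} P] [Category.{v} X]

/-- A transformation of balanced functors is a natural transformation commuting with the balancing
isomorphisms. -/
@[ext]
structure Hom (F G : BalancedFunctor D A B X) where
  natTrans : F.functor ⟶ G.functor
  comm (a : A) (x : D) (b : B) :
    natTrans.app (a ⊙ᵣ x, b) ≫ (G.bal.iso a x b).hom = (F.bal.iso a x b).hom ≫ natTrans.app (a, x ⊙ₗ b)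

/-- The category of balanced functors `A × B ⥤ X`. -/
instance : Category (BalancedFunctor D A B X) where
  Hom F G := Hom F G
  id F := { natTrans := 𝟙 F.functor, comm := by simp }
  comp α β :=
    { natTrans := α.natTrans ≫ β.natTrans
      comm := fun a x b => by simp [β.comm, reassoc_of% (α.comm a x b)] }
  id_comp α := Hom.ext (Category.id_comp α.natTrans)
  comp_id α := Hom.ext (Category.comp_id α.natTrans)
  assoc α β γ := Hom.ext (Category.assoc α.natTrans β.natTrans γ.natTrans)

/-- The composite of a balanced functor `A × B ⥤ P` with a functor `P ⥤ X`. -/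
def postcomp (p : BalancedFunctor D A B P) (H : P ⥤ X) : BalancedFunctor D A B X where
  functor := p.functor ⋙ H
  bal :=
    { iso := fun a x b => H.mapIso (p.bal.iso a x b)
      naturality := fun f g h => by
        simp only [Functor.comp_map, Functor.mapIso_hom, ← Functor.map_comp, p.bal.naturality]
      associativity := fun a x y b => by
        simp only [Functor.comp_map, Functor.mapIso_hom, ← Functor.map_comp, p.bal.associativity]
      unitality := fun a b => by
        simp only [Functor.comp_map, Functor.mapIso_hom, ← Functor.map_comp, p.bal.unitality] }

/-- The comparison functor from functors `P ⥤ X` to balanced functors `A × B ⥤ X`. -/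
def comparison (p : BalancedFunctor D A B P) (X : Type u) [Category.{v} X] :
    (P ⥤ X) ⥤ BalancedFunctor D A B X where
  obj H := p.postcomp H
  map θ :=
    { natTrans := Functor.whiskerLeft p.functor θ
      comm := fun a x b => (θ.naturality (p.bal.iso a x b).hom).symm }
  map_id _ := Hom.ext rfl
  map_comp _ _ := Hom.ext rfl

/-- The balanced functor `p : A × B ⥤ P` is the (coherent) pseudocoequalizer of `◁ × B` and `A × ▷`
in `Cat`, the 2-cell being coherent for the constraints of the actions: composition with it is an isomorphism of categories from functors `P ⥤ X` to balanced functors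
`A × B ⥤ X`, for each category `X`. -/
def IsPseudocoequalizer (p : BalancedFunctor D A B P) : Prop :=
  ∀ (X : Type u) [Category.{v} X],
    Function.Bijective (p.comparison X).obj ∧ (p.comparison X).Full ∧ (p.comparison X).Faithful

end BalancedFunctor

namespace Biactegory

variable {C : Type u} [Category.{v} C] [MonoidalCategory C]
  {D : Type u} [Category.{v} D] [MonoidalCategory D]
  {E : Type u} [Category.{v} E] [MonoidalCategory E]

variable (C) in
/-- The regular biactegory: `C` acting on itself on both sides by its tensor product. -/
@[reducible]
def regular : Biactegory.{v, u} C C where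
  carrier := C
  law :=
    { app := fun c a d => (α_ c a d).inv
      naturality := fun f g h => by simp
      left_pentagon := fun c c' a d => by simp
      right_pentagon := fun c a d d' => by simp
      left_triangle := fun a d => by simp
      right_triangle := fun c a => by simp }
  isIso_law c a d := by dsimp only; infer_instance

/-- The left action of `C` on the first factor of `A × B`. -/
@[reducible]
def prodLeftAction (A B : Type u) [Category.{v} A] [Category.{v} B] [MonoidalLeftAction C A] :
    MonoidalLeftAction C (A × B) where
  actionObj c x := (c ⊙ₗ x.1, x.2)
  actionHomLeft f x := (f ⊵ₗ x.1, 𝟙 x.2)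
  actionHomRight c _ _ f := (c ⊴ₗ f.1, f.2)
  actionHom f g := (f ⊙ₗₘ g.1, g.2)
  actionAssocIso c c' x := (αₗ c c' x.1).prod (Iso.refl x.2)
  actionUnitIso x := (λₗ x.1).prod (Iso.refl x.2)
  actionHom_def f g := Prod.ext (MonoidalLeftAction.actionHom_def f g.1) (by simp)
  actionAssocIso_hom_naturality f g h :=
    Prod.ext (MonoidalLeftAction.actionAssocIso_hom_naturality f g h.1) (by simp)

/-- The right action of `E` on the second factor of `A × B`. -/
@[reducible]
def prodRightAction (A B : Type u) [Category.{v} A] [Category.{v} B] [MonoidalRightAction E B] :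
    MonoidalRightAction E (A × B) where
  actionObj x e := (x.1, x.2 ⊙ᵣ e)
  actionHomRight x _ _ f := (𝟙 x.1, x.2 ⊴ᵣ f)
  actionHomLeft f e := (f.1, f.2 ⊵ᵣ e)
  actionHom f g := (f.1, f.2 ⊙ᵣₘ g)
  actionAssocIso x e e' := (Iso.refl x.1).prod (αᵣ x.2 e e')
  actionUnitIso x := (Iso.refl x.1).prod (ρᵣ x.2)
  actionHom_def f g := Prod.ext (by simp) (MonoidalRightAction.actionHom_def f.2 g)
  actionAssocIso_hom_naturality f g h :=
    Prod.ext (by simp) (MonoidalRightAction.actionAssocIso_hom_naturality f.2 g h)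

/-- The product of the carriers of a `C`-`D`-biactegory `M` and a `D`-`E`-biactegory `N`, as a
`C`-`E`-biactegory: `C` acts on the first factor, `E` on the second, and the distributive law is
the identity. -/
@[reducible]
def outer (M : Biactegory.{v, u} C D) (N : Biactegory.{v, u} D E) : Biactegory.{v, u} C E where
  carrier := M.carrier × N.carrier
  leftAction := prodLeftAction M.carrier N.carrier
  rightAction := prodRightAction M.carrier N.carrier
  law :=
    letI := prodLeftAction (C := C) M.carrier N.carrier
    letI := prodRightAction (E := E) M.carrier N.carrier
    { app := fun c x e => 𝟙 ((c ⊙ₗ x.1, x.2 ⊙ᵣ e) : M.carrier × N.carrier)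
      naturality := fun f g h =>
        Prod.ext ((Category.comp_id _).trans (Category.id_comp _).symm)
          ((Category.comp_id _).trans (Category.id_comp _).symm)
      left_pentagon := fun c c' x e => Prod.ext
        (by
          change (αₗ c c' x.1).hom ≫ c ⊴ₗ 𝟙 _ ≫ 𝟙 _ = 𝟙 _ ≫ (αₗ c c' x.1).hom
          simp)
        (by
          change 𝟙 _ ≫ 𝟙 _ ≫ 𝟙 _ = 𝟙 _ ≫ (𝟙 x.2) ⊵ᵣ e
          simp)
      right_pentagon := fun c x e e' => Prod.ext
        (by
          change c ⊴ₗ 𝟙 x.1 ≫ 𝟙 _ ≫ 𝟙 _ = 𝟙 _ ≫ 𝟙 _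
          simp)
        (by
          change (αᵣ x.2 e e').hom ≫ 𝟙 _ ≫ (𝟙 (x.2 ⊙ᵣ e)) ⊵ᵣ e' = 𝟙 _ ≫ (αᵣ x.2 e e').hom
          simp)
      left_triangle := fun x e => Prod.ext (Category.id_comp _)
        ((Category.id_comp _).trans (MonoidalRightAction.id_actionHomLeft e x.2))
      right_triangle := fun c x => Prod.ext
        ((Category.id_comp _).trans (MonoidalLeftAction.actionHomRight_id c x.1).symm)
        (Category.id_comp _) }
  isIso_law c x e := by dsimp only; infer_instance

/-- A tensor product `M ⊗_D N` of a `C`-`D`-biactegory `M` and a `D`-`E`-biactegory `N`: the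
pseudocoequalizer of `◁ × N` and `M × ▷`, with the `C`-`E`-biactegory structure inherited from the
outer actions on `M × N`. -/
structure TensorProduct (M : Biactegory.{v, u} C D) (N : Biactegory.{v, u} D E) where
  /-- the biactegory `M ⊗_D N` -/
  vertex : Biactegory.{v, u} C E
  /-- the projection `p : M × N ⥤ M ⊗_D N`, equivariant for the outer actions -/
  proj : ColaxBiequivariantFunctor (outer M N) vertex
  /-- `p (c ▷ m, n) = c ▷ p (m, n)` -/
  proj_left (c : C) (x : M.carrier × N.carrier) : IsIdentity (proj.leftCoh c x)
  /-- `p (m, n ◁ e) = p (m, n) ◁ e` -/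
  proj_right (x : M.carrier × N.carrier) (e : E) : IsIdentity (proj.rightCoh x e)
  /-- the isomorphisms `σ : p (m ◁ d, n) ≅ p (m, d ▷ n)` -/
  bal : Balancing D (A := M.carrier) (B := N.carrier) proj.functor
  isPseudocoequalizer : (BalancedFunctor.mk proj.functor bal).IsPseudocoequalizer
  /-- compatibility of `σ` with the left actions and the distributive law of `M` -/
  bal_left (c : C) (m : M.carrier) (d : D) (n : N.carrier) :
    proj.leftCoh c (m ⊙ᵣ d, n) ≫ c ⊴ₗ (bal.iso m d n).hom =
      proj.functor.map ((M.law.app c m d, 𝟙 n) :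
          ((c ⊙ₗ (m ⊙ᵣ d), n) : M.carrier × N.carrier) ⟶ ((c ⊙ₗ m) ⊙ᵣ d, n)) ≫
        (bal.iso (c ⊙ₗ m) d n).hom ≫ proj.leftCoh c (m, d ⊙ₗ n)
  /-- compatibility of `σ` with the right actions and the distributive law of `N` -/
  bal_right (m : M.carrier) (d : D) (n : N.carrier) (e : E) :
    proj.rightCoh (m ⊙ᵣ d, n) e ≫ (bal.iso m d n).hom ⊵ᵣ e =
      (bal.iso m d (n ⊙ᵣ e)).hom ≫
        proj.functor.map ((𝟙 m, N.law.app d n e) :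
          ((m, d ⊙ₗ (n ⊙ᵣ e)) : M.carrier × N.carrier) ⟶ (m, (d ⊙ₗ n) ⊙ᵣ e)) ≫
        proj.rightCoh (m, d ⊙ₗ n) e

end Biactegory
end TensorProduct

/-! The tensor product is the factorization of the action `G × M ⥤ M` into a functor bijective on
objects followed by a fully faithful one: objects are formal pairs `(g, m)`, and morphisms `(g, m) ⟶
(g', m')` are morphisms `g ▷ m ⟶ g' ▷ m'` of `M`. Put `c ▷ (g, m) = (c ⊗ g, m)` and `(g, m) ◁ d =
(g, m ◁ d)`. These operations touch different coordinates, so they commute strictly and the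
distributive law can be the identity. The law of `M` is not lost: it becomes the coherence `g ▷ (m ◁
d) ≅ (g ▷ m) ◁ d` of the fully faithful functor to `M`, along which both actions are transported.
The left pentagon makes the identity law match that of `M` (`inducedBiactegory`).

This functor is fully faithful and strong, and `m ↦ (1, m)` is a section up to the unit constraint.
`nonempty_equivalence_of_section` turns this into a biequivalence.

For universality, a balanced functor `K` has isomorphisms `K(g, m) ≅ K(1 ⊗ g, m) ≅ K(1, g ▷ m)`, so
it extends to a morphism `f` by conjugating `K(1, f)`. By `regularTensor_hom_eq` every morphism is a
composite of projected morphisms and balancing components, which forces this formula. As the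
projection is the identity on objects, the correspondence is bijective and not just an equivalence.
-/

section InducedActions

/-! ### Transport of actions along a fully faithful functor. -/

variable {C : Type u} [Category.{v} C] [MonoidalCategory C]
  {D : Type u} [Category.{v} D] [MonoidalCategory D]
  {A P : Type u} [Category.{v} A]

/-- A left action transported along the fully faithful functor from an induced category. -/
@[reducible]
def inducedLeftAction [MonoidalLeftAction C A] (E : P → A) (act : C → P → P)
    (κ : ∀ c p, E (act c p) ≅ c ⊙ₗ E p) : MonoidalLeftAction C (InducedCategory A E) where
  actionObj := act
  actionHomLeft {c c'} f p := InducedCategory.homMk (X := act c p) (Y := act c' p)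
    ((κ c p).hom ≫ f ⊵ₗ E p ≫ (κ c' p).inv)
  actionHomRight c {p p'} g := InducedCategory.homMk (X := act c p) (Y := act c p')
    ((κ c p).hom ≫ c ⊴ₗ g.hom ≫ (κ c p').inv)
  actionHom {c c' p p'} f g := InducedCategory.homMk (X := act c p) (Y := act c' p')
    ((κ c p).hom ≫ (f ⊙ₗₘ g.hom) ≫ (κ c' p').inv)
  actionAssocIso c c' p := InducedCategory.isoMk (X := act (c ⊗ c') p) (Y := act c (act c' p))
    { hom := (κ (c ⊗ c') p).hom ≫ (αₗ c c' (E p)).hom ≫ c ⊴ₗ (κ c' p).inv ≫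
        (κ c (act c' p)).inv
      inv := (κ c (act c' p)).hom ≫ c ⊴ₗ (κ c' p).hom ≫ (αₗ c c' (E p)).inv ≫
        (κ (c ⊗ c') p).inv }
  actionUnitIso p := InducedCategory.isoMk (X := act (𝟙_ C) p) (Y := p) (κ (𝟙_ C) p ≪≫ λₗ (E p))
  actionHom_def f g := by ext; simp [MonoidalLeftAction.actionHom_def]
  actionHomRight_id c p := by ext; simp
  id_actionHomLeft c p := by ext; simp
  actionHom_comp f f' g g' := by ext; simp
  actionAssocIso_hom_naturality f g h := by
    ext
    simp only [InducedCategory.comp_hom, InducedCategory.homMk_hom, InducedCategory.isoMk_hom,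
      Category.assoc, Iso.inv_hom_id_assoc, MonoidalLeftAction.actionAssocIso_hom_naturality_assoc]
    -- Written as two-variable actions, the whiskered `κ` and its inverse meet and cancel by
    -- bifunctoriality.
    simp only [← MonoidalLeftAction.id_actionHom, ← MonoidalLeftAction.actionHom_comp_assoc,
      Category.id_comp, Category.comp_id, Iso.inv_hom_id_assoc]
  actionUnitIso_hom_naturality g := by ext; simp
  whiskerLeft_actionHomLeft c _ _ f p := by ext; simp
  whiskerRight_actionHomLeft c f p := by
    ext
    -- `actionHomLeft_action` is held back until the exchange law has moved `f` past the whiskered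
    -- `κ`.
    simp [← MonoidalLeftAction.action_exchange_assoc, -MonoidalLeftAction.actionHomLeft_action]
    simp
  associator_actionHom c c' c'' p := by ext; simp
  leftUnitor_actionHom c p := by ext; simp
  rightUnitor_actionHom c p := by ext; simp

/-- A right action transported along the fully faithful functor from an induced category. -/
@[reducible]
def inducedRightAction [MonoidalRightAction D A] (E : P → A) (act : P → D → P)
    (κ : ∀ p d, E (act p d) ≅ E p ⊙ᵣ d) : MonoidalRightAction D (InducedCategory A E) where
  actionObj := act
  actionHomLeft {p p'} g d := InducedCategory.homMk (X := act p d) (Y := act p' d)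
    ((κ p d).hom ≫ g.hom ⊵ᵣ d ≫ (κ p' d).inv)
  actionHomRight p {d d'} f := InducedCategory.homMk (X := act p d) (Y := act p d')
    ((κ p d).hom ≫ E p ⊴ᵣ f ≫ (κ p d').inv)
  actionHom {d d' p p'} g f := InducedCategory.homMk
    ((κ _ _).hom ≫ (g.hom ⊙ᵣₘ f) ≫ (κ _ _).inv)
  actionAssocIso p d d' := InducedCategory.isoMk (X := act p (d ⊗ d')) (Y := act (act p d) d')
    { hom := (κ p (d ⊗ d')).hom ≫ (αᵣ (E p) d d').hom ≫ (κ p d).inv ⊵ᵣ d' ≫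
        (κ (act p d) d').inv
      inv := (κ (act p d) d').hom ≫ (κ p d).hom ⊵ᵣ d' ≫ (αᵣ (E p) d d').inv ≫
        (κ p (d ⊗ d')).inv }
  actionUnitIso p := InducedCategory.isoMk (X := act p (𝟙_ D)) (Y := p) (κ p (𝟙_ D) ≪≫ ρᵣ (E p))
  actionHom_def f g := by ext; simp [MonoidalRightAction.actionHom_def]
  actionHomRight_id c p := by ext; simp
  id_actionHomLeft c p := by ext; simp
  actionHom_comp f f' g g' := by ext; simp
  actionAssocIso_hom_naturality f g h := by
    ext
    simp only [InducedCategory.comp_hom, InducedCategory.homMk_hom, InducedCategory.isoMk_hom,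
      Category.assoc, Iso.inv_hom_id_assoc, MonoidalRightAction.actionAssocIso_hom_naturality_assoc]
    simp only [← MonoidalRightAction.actionHom_id, ← MonoidalRightAction.actionHom_comp_assoc,
      Category.id_comp, Category.comp_id, Iso.inv_hom_id_assoc]
  actionUnitIso_hom_naturality g := by ext; simp
  actionHomRight_whiskerRight f c p := by ext; simp
  whiskerRight_actionHomLeft c _ _ f p := by
    ext
    simp [MonoidalRightAction.action_exchange_assoc]
  actionHom_associator c c' c'' p := by ext; simp
  actionHom_leftUnitor c p := by ext; simp
  actionHom_rightUnitor c p := by ext; simp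

/-- The fully faithful functor from an induced category is linear for the transported left
action. -/
@[reducible]
def inducedFunctorOplaxLeftLinear [MonoidalLeftAction C A] (E : P → A) (act : C → P → P)
    (κ : ∀ c p, E (act c p) ≅ c ⊙ₗ E p) :
    letI := inducedLeftAction E act κ
    (inducedFunctor E).OplaxLeftLinear C :=
  letI := inducedLeftAction E act κ
  { δₗ c p := (κ c p).hom
    δₗ_naturality_left {c c'} f p := by
      change ((κ c p).hom ≫ f ⊵ₗ E p ≫ (κ c' p).inv) ≫ (κ c' p).hom = (κ c p).hom ≫ f ⊵ₗ E p
      simp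
    δₗ_naturality_right c p p' g := by
      change ((κ c p).hom ≫ c ⊴ₗ g.hom ≫ (κ c p').inv) ≫ (κ c p').hom = (κ c p).hom ≫ c ⊴ₗ g.hom
      simp
    δₗ_associativity c c' p := by
      change (κ (c ⊗ c') p).hom ≫ (αₗ c c' (E p)).hom =
        ((κ (c ⊗ c') p).hom ≫ (αₗ c c' (E p)).hom ≫ c ⊴ₗ (κ c' p).inv ≫ (κ c (act c' p)).inv) ≫
          (κ c (act c' p)).hom ≫ c ⊴ₗ (κ c' p).hom
      simp
    δₗ_unitality_inv p := by
      change (λₗ (E p)).inv = ((λₗ (E p)).inv ≫ (κ (𝟙_ C) p).inv) ≫ (κ (𝟙_ C) p).hom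
      simp }

/-- The fully faithful functor from an induced category is linear for the transported right
action. -/
@[reducible]
def inducedFunctorOplaxRightLinear [MonoidalRightAction D A] (E : P → A) (act : P → D → P)
    (κ : ∀ p d, E (act p d) ≅ E p ⊙ᵣ d) :
    letI := inducedRightAction E act κ
    (inducedFunctor E).OplaxRightLinear D :=
  letI := inducedRightAction E act κ
  { δᵣ p d := (κ p d).hom
    δᵣ_naturality_left {p p'} g d := by
      change ((κ p d).hom ≫ g.hom ⊵ᵣ d ≫ (κ p' d).inv) ≫ (κ p' d).hom = (κ p d).hom ≫ g.hom ⊵ᵣ d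
      simp
    δᵣ_naturality_right p d d' f := by
      change ((κ p d).hom ≫ E p ⊴ᵣ f ≫ (κ p d').inv) ≫ (κ p d').hom = (κ p d).hom ≫ E p ⊴ᵣ f
      simp
    δᵣ_associativity p d d' := by
      change (κ p (d ⊗ d')).hom ≫ (αᵣ (E p) d d').hom =
        ((κ p (d ⊗ d')).hom ≫ (αᵣ (E p) d d').hom ≫ (κ p d).inv ⊵ᵣ d' ≫ (κ (act p d) d').inv) ≫
          (κ (act p d) d').hom ≫ (κ p d).hom ⊵ᵣ d'
      simp
    δᵣ_unitality_inv p := by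
      change (ρᵣ (E p)).inv = ((ρᵣ (E p)).inv ≫ (κ p (𝟙_ D)).inv) ≫ (κ p (𝟙_ D)).hom
      simp }

end InducedActions

/-! ### Reflecting a distributive law along a faithful strong functor. -/

section DistributiveLawReflection

open Functor.OplaxLeftLinear Functor.OplaxRightLinear

variable {C : Type u} [Category.{v} C] [MonoidalCategory C]
  {D : Type u} [Category.{v} D] [MonoidalCategory D]
  {A P : Type u} [Category.{v} A] [Category.{v} P]
  [MonoidalLeftAction C A] [MonoidalRightAction D A]
  [MonoidalLeftAction C P] [MonoidalRightAction D P]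

theorem map_actionHom_oplaxLeftLinear (F : P ⥤ A) [F.OplaxLeftLinear C] {c c' : C} {p p' : P}
    (f : c ⟶ c') (g : p ⟶ p') :
    F.map (f ⊙ₗₘ g) ≫ δₗ F c' p' = δₗ F c p ≫ (f ⊙ₗₘ F.map g) := by
  simp [MonoidalLeftAction.actionHom_def]

theorem map_actionHom_oplaxRightLinear (F : P ⥤ A) [F.OplaxRightLinear D] {d d' : D} {p p' : P}
    (g : p ⟶ p') (f : d ⟶ d') :
    F.map (g ⊙ᵣₘ f) ≫ δᵣ F p' d' = δᵣ F p d ≫ (F.map g ⊙ᵣₘ f) := by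
  simp [MonoidalRightAction.actionHom_def]

/-- The case used to slide a coherence or a unit isomorphism, sitting in the middle variable, past
the law. -/
theorem DistributiveLaw.naturality_middle (L : DistributiveLaw C D A) (c : C) {a a' : A}
    (g : a ⟶ a') (d : D) :
    c ⊴ₗ (g ⊵ᵣ d) ≫ L.app c a' d = L.app c a d ≫ (c ⊴ₗ g) ⊵ᵣ d := by
  simpa using L.naturality (𝟙 c) g (𝟙 d)

/-- A distributive law is reflected by a faithful functor that is strongly linear on both sides. -/
@[reducible]
def DistributiveLaw.ofFaithful (L : DistributiveLaw C D A) (F : P ⥤ A) [F.Faithful]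
    [F.OplaxLeftLinear C] [F.OplaxRightLinear D]
    [∀ (c : C) p, IsIso (δₗ F c p)] [∀ p (d : D), IsIso (δᵣ F p d)]
    (app : ∀ (c : C) (p : P) (d : D), c ⊙ₗ (p ⊙ᵣ d) ⟶ (c ⊙ₗ p) ⊙ᵣ d)
    (h : ∀ c p d, F.map (app c p d) ≫ δᵣ F (c ⊙ₗ p) d ≫ δₗ F c p ⊵ᵣ d =
      δₗ F c (p ⊙ᵣ d) ≫ c ⊴ₗ δᵣ F p d ≫ L.app c (F.obj p) d) :
    DistributiveLaw C D P where
  app := app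
  naturality {c c' p p' d d'} f g k := by
    -- Each axiom follows this pattern: apply the faithful `F`, then postcompose with invertible
    -- coherences, so that `h` replaces `app` by `L.app` and the axiom for `L` applies.
    apply F.map_injective
    rw [← cancel_mono (δᵣ F (c' ⊙ₗ p') d' ≫ δₗ F c' p' ⊵ᵣ d')]
    simp only [Functor.map_comp, Category.assoc, h,
      reassoc_of% (map_actionHom_oplaxLeftLinear (C := C) F),
      reassoc_of% (map_actionHom_oplaxRightLinear (D := D) F)]
    have e1 : (f ⊙ₗₘ F.map (g ⊙ᵣₘ k)) ≫ c' ⊴ₗ δᵣ F p' d' =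
        c ⊴ₗ δᵣ F p d ≫ (f ⊙ₗₘ (F.map g ⊙ᵣₘ k)) := by
      simp only [← MonoidalLeftAction.id_actionHom, ← MonoidalLeftAction.actionHom_comp,
        map_actionHom_oplaxRightLinear, Category.id_comp, Category.comp_id]
    have e2 : (F.map (f ⊙ₗₘ g) ⊙ᵣₘ k) ≫ δₗ F c' p' ⊵ᵣ d' =
        δₗ F c p ⊵ᵣ d ≫ ((f ⊙ₗₘ F.map g) ⊙ᵣₘ k) := by
      simp only [← MonoidalRightAction.actionHom_id, ← MonoidalRightAction.actionHom_comp,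
        map_actionHom_oplaxLeftLinear, Category.id_comp, Category.comp_id]
    rw [reassoc_of% e1, L.naturality, e2, reassoc_of% (h c p d)]
  left_pentagon c c' p d := by
    apply F.map_injective
    rw [← cancel_mono (δᵣ F (c ⊙ₗ c' ⊙ₗ p) d ≫ (δₗ F c (c' ⊙ₗ p) ≫ c ⊴ₗ δₗ F c' p) ⊵ᵣ d)]
    -- `hr` carries the right side of the pentagon to that of `L`; `hl` treats the inner law,
    -- whiskered by `c`.
    have hr : F.map (app (c ⊗ c') p d) ≫ F.map ((αₗ c c' p).hom ⊵ᵣ d) ≫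
        δᵣ F (c ⊙ₗ c' ⊙ₗ p) d ≫ (δₗ F c (c' ⊙ₗ p) ≫ c ⊴ₗ δₗ F c' p) ⊵ᵣ d =
        δₗ F (c ⊗ c') (p ⊙ᵣ d) ≫ (c ⊗ c') ⊴ₗ δᵣ F p d ≫ L.app (c ⊗ c') (F.obj p) d ≫
          (αₗ c c' (F.obj p)).hom ⊵ᵣ d := by
      rw [δᵣ_naturality_left_assoc, ← MonoidalRightAction.comp_actionHomLeft,
        ← δₗ_associativity, MonoidalRightAction.comp_actionHomLeft, reassoc_of% (h _ _ _)]
    have hl : c ⊴ₗ F.map (app c' p d) ≫ c ⊴ₗ δᵣ F (c' ⊙ₗ p) d ≫ L.app c (F.obj (c' ⊙ₗ p)) d ≫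
        (c ⊴ₗ δₗ F c' p) ⊵ᵣ d =
        c ⊴ₗ δₗ F c' (p ⊙ᵣ d) ≫ c ⊴ₗ c' ⊴ₗ δᵣ F p d ≫ c ⊴ₗ L.app c' (F.obj p) d ≫
          L.app c (c' ⊙ₗ F.obj p) d := by
      rw [← L.naturality_middle]
      simp only [← MonoidalLeftAction.actionHomRight_comp_assoc, h]
    simp only [Functor.map_comp, Category.assoc, hr]
    rw [MonoidalRightAction.comp_actionHomLeft, reassoc_of% (h _ _ _),
      δₗ_naturality_right_assoc, hl, ← δₗ_associativity_assoc, ← L.left_pentagon]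
    simp
  right_pentagon c p d d' := by
    apply F.map_injective
    rw [← cancel_mono (δᵣ F ((c ⊙ₗ p) ⊙ᵣ d) d' ≫ (δᵣ F (c ⊙ₗ p) d ≫ δₗ F c p ⊵ᵣ d) ⊵ᵣ d')]
    have hl : F.map (app c p d ⊵ᵣ d') ≫ δᵣ F ((c ⊙ₗ p) ⊙ᵣ d) d' ≫
        (δᵣ F (c ⊙ₗ p) d ≫ δₗ F c p ⊵ᵣ d) ⊵ᵣ d' =
        δᵣ F (c ⊙ₗ p ⊙ᵣ d) d' ≫ δₗ F c (p ⊙ᵣ d) ⊵ᵣ d' ≫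
          (c ⊴ₗ δᵣ F p d ≫ L.app c (F.obj p) d) ⊵ᵣ d' := by
      rw [δᵣ_naturality_left_assoc, ← MonoidalRightAction.comp_actionHomLeft, h,
        MonoidalRightAction.comp_actionHomLeft]
    have hr : F.map (αᵣ (c ⊙ₗ p) d d').hom ≫ δᵣ F ((c ⊙ₗ p) ⊙ᵣ d) d' ≫
        (δᵣ F (c ⊙ₗ p) d ≫ δₗ F c p ⊵ᵣ d) ⊵ᵣ d' =
        δᵣ F (c ⊙ₗ p) (d ⊗ d') ≫ δₗ F c p ⊵ᵣ (d ⊗ d') ≫ (αᵣ (c ⊙ₗ F.obj p) d d').hom := by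
      rw [MonoidalRightAction.comp_actionHomLeft, ← δᵣ_associativity_assoc]
      simp
    simp only [Functor.map_comp, Category.assoc, hl, hr]
    rw [reassoc_of% (h _ _ _), reassoc_of% (h _ _ _), ← L.right_pentagon,
      MonoidalRightAction.comp_actionHomLeft, ← reassoc_of% L.naturality_middle,
      δₗ_naturality_right_assoc]
    simp only [← MonoidalLeftAction.actionHomRight_comp_assoc, δᵣ_associativity]
  left_triangle p d := by
    apply F.map_injective
    rw [← cancel_mono (δᵣ F p d), Functor.map_comp, Category.assoc, δᵣ_naturality_left,
      ← δₗ_unitality_hom, MonoidalRightAction.comp_actionHomLeft, reassoc_of% (h _ _ _),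
      L.left_triangle, ← δₗ_unitality_hom]
    simp
  right_triangle c p := by
    apply F.map_injective
    rw [← cancel_mono (δₗ F c p), Functor.map_comp, Category.assoc, δₗ_naturality_right,
      ← δᵣ_unitality_hom, ← δᵣ_unitality_hom, MonoidalLeftAction.actionHomRight_comp,
      ← L.right_triangle, ← reassoc_of% (h _ _ _)]
    simp

end DistributiveLawReflection

/-! ### Biactegories on induced categories. -/

section InducedBiactegory

variable {C : Type u} [Category.{v} C] [MonoidalCategory C]
  {D : Type u} [Category.{v} D] [MonoidalCategory D] {P : Type u}

/-- A biactegory structure transported along the fully faithful functor from an induced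
category. -/
@[reducible]
def inducedBiactegory (M : Biactegory.{v, u} C D) (E : P → M.carrier) (actL : C → P → P)
    (κ : ∀ c p, E (actL c p) ≅ c ⊙ₗ E p) (actR : P → D → P)
    (ρ : ∀ p d, E (actR p d) ≅ E p ⊙ᵣ d)
    (app : ∀ c p d, E (actL c (actR p d)) ≅ E (actR (actL c p) d))
    (h : ∀ c p d, (app c p d).hom ≫ (ρ (actL c p) d).hom ≫ (κ c p).hom ⊵ᵣ d =
      (κ c (actR p d)).hom ≫ c ⊴ₗ (ρ p d).hom ≫ M.law.app c (E p) d) : Biactegory.{v, u} C D :=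
  letI := inducedLeftAction E actL κ
  letI := inducedRightAction E actR ρ
  letI := inducedFunctorOplaxLeftLinear E actL κ
  letI := inducedFunctorOplaxRightLinear E actR ρ
  haveI : ∀ (c : C) p, IsIso (Functor.OplaxLeftLinear.δₗ (inducedFunctor E) c p) :=
    fun c p => inferInstanceAs (IsIso (κ c p).hom)
  haveI : ∀ p (d : D), IsIso (Functor.OplaxRightLinear.δᵣ (inducedFunctor E) p d) :=
    fun p d => inferInstanceAs (IsIso (ρ p d).hom)
  { carrier := InducedCategory M.carrier E
    law := M.law.ofFaithful (inducedFunctor E) (fun c p d => InducedCategory.homMk (app c p d).hom)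
      h
    isIso_law c p d := (InducedCategory.isoMk
      (X := (c ⊙ₗ (p ⊙ᵣ d) : InducedCategory M.carrier E)) (Y := ((c ⊙ₗ p) ⊙ᵣ d))
      (app c p d)).isIso_hom }

/-- The fully faithful functor from an induced biactegory is biequivariant. -/
def inducedBiequivariantFunctor (M : Biactegory.{v, u} C D) (E : P → M.carrier) (actL : C → P → P)
    (κ : ∀ c p, E (actL c p) ≅ c ⊙ₗ E p) (actR : P → D → P)
    (ρ : ∀ p d, E (actR p d) ≅ E p ⊙ᵣ d)
    (app : ∀ c p d, E (actL c (actR p d)) ≅ E (actR (actL c p) d))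
    (h : ∀ c p d, (app c p d).hom ≫ (ρ (actL c p) d).hom ≫ (κ c p).hom ⊵ᵣ d =
      (κ c (actR p d)).hom ≫ c ⊴ₗ (ρ p d).hom ≫ M.law.app c (E p) d) :
    ColaxBiequivariantFunctor (inducedBiactegory M E actL κ actR ρ app h) M where
  functor := inducedFunctor E
  left := inducedFunctorOplaxLeftLinear E actL κ
  right := inducedFunctorOplaxRightLinear E actR ρ
  law_comp c p d := (h c p d).symm

end InducedBiactegory

/-! ### From a section of a fully faithful strong functor to a biequivalence. -/

section Equivalences

variable {C : Type u} [Category.{v} C] [MonoidalCategory C]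
  {D : Type u} [Category.{v} D] [MonoidalCategory D] {M N : Biactegory.{v, u} C D}

open Functor.OplaxLeftLinear Functor.OplaxRightLinear

namespace ColaxBiequivariantFunctor

variable (F : ColaxBiequivariantFunctor M N) (G : N.carrier ⥤ M.carrier)
  (e : G ⋙ F.functor ≅ 𝟭 N.carrier)

/-- Naturality of `e` with the composite and identity functors spelled out, a form that rewriting
can match; likewise for the next three. -/
theorem section_map (b b' : N.carrier) (f : b ⟶ b') :
    F.functor.map (G.map f) ≫ e.hom.app b' = e.hom.app b ≫ f :=
  e.hom.naturality f

theorem section_map_inv (b b' : N.carrier) (f : b ⟶ b') :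
    e.inv.app b ≫ F.functor.map (G.map f) = f ≫ e.inv.app b' :=
  (e.inv.naturality f).symm

theorem section_hom_inv (b : N.carrier) :
    e.hom.app b ≫ e.inv.app b = 𝟙 (F.functor.obj (G.obj b)) :=
  e.hom_inv_id_app b

theorem section_inv_hom (b : N.carrier) : e.inv.app b ≫ e.hom.app b = 𝟙 b :=
  e.inv_hom_id_app b

/-- The coherence of a section of a strong left linear fully faithful functor. -/
noncomputable def sectionLeftCoh [F.functor.Full] [∀ (c : C) a, IsIso (F.leftCoh c a)]
    (c : C) (b : N.carrier) : G.obj (c ⊙ₗ b) ⟶ c ⊙ₗ G.obj b :=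
  F.functor.preimage (e.hom.app (c ⊙ₗ b) ≫ c ⊴ₗ e.inv.app b ≫ inv (F.leftCoh c (G.obj b)))

/-- The coherence of a section of a strong right linear fully faithful functor. -/
noncomputable def sectionRightCoh [F.functor.Full] [∀ a (d : D), IsIso (F.rightCoh a d)]
    (b : N.carrier) (d : D) : G.obj (b ⊙ᵣ d) ⟶ G.obj b ⊙ᵣ d :=
  F.functor.preimage (e.hom.app (b ⊙ᵣ d) ≫ e.inv.app b ⊵ᵣ d ≫ inv (F.rightCoh (G.obj b) d))

/-- This characterizes the coherence without a preimage or an inverse; the later computations use it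
instead of the definition. -/
theorem map_sectionLeftCoh [F.functor.Full] [∀ (c : C) a, IsIso (F.leftCoh c a)]
    (c : C) (b : N.carrier) :
    F.functor.map (F.sectionLeftCoh G e c b) ≫ F.leftCoh c (G.obj b) =
      e.hom.app (c ⊙ₗ b) ≫ c ⊴ₗ e.inv.app b := by
  simp [sectionLeftCoh]

theorem map_sectionRightCoh [F.functor.Full] [∀ a (d : D), IsIso (F.rightCoh a d)]
    (b : N.carrier) (d : D) :
    F.functor.map (F.sectionRightCoh G e b d) ≫ F.rightCoh (G.obj b) d =
      e.hom.app (b ⊙ᵣ d) ≫ e.inv.app b ⊵ᵣ d := by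
  simp [sectionRightCoh]

variable [F.functor.Full] [F.functor.Faithful]
  [∀ (c : C) a, IsIso (F.leftCoh c a)] [∀ a (d : D), IsIso (F.rightCoh a d)]

/-- A section of a strong biequivariant fully faithful functor is biequivariant. -/
noncomputable def sectionFunctor : ColaxBiequivariantFunctor N M where
  functor := G
  left :=
    { δₗ c b := F.sectionLeftCoh G e c b
      δₗ_naturality_left {c c'} f b := by
        -- As for the remaining axioms: after applying `F` and cancelling its coherence, only `e`,
        -- its inverse and the structure of `N` are left.
        apply F.functor.map_injective
        rw [← cancel_mono (F.leftCoh c' (G.obj b))]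
        simp only [Functor.map_comp, Category.assoc, map_sectionLeftCoh,
          reassoc_of% (F.section_map G e),
          δₗ_naturality_left, reassoc_of% (F.map_sectionLeftCoh G e),
          MonoidalLeftAction.action_exchange]
      δₗ_naturality_right c b b' f := by
        apply F.functor.map_injective
        rw [← cancel_mono (F.leftCoh c (G.obj b'))]
        simp only [Functor.map_comp, Category.assoc, map_sectionLeftCoh,
          reassoc_of% (F.section_map G e),
          δₗ_naturality_right, reassoc_of% (F.map_sectionLeftCoh G e),
          ← MonoidalLeftAction.actionHomRight_comp,
          section_map_inv]
      δₗ_associativity c c' b := by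
        apply F.functor.map_injective
        rw [← cancel_mono (F.leftCoh c (c' ⊙ₗ G.obj b) ≫ c ⊴ₗ F.leftCoh c' (G.obj b))]
        simp only [Functor.map_comp, Category.assoc, ← δₗ_associativity,
          reassoc_of% (F.map_sectionLeftCoh G e),
          reassoc_of% (F.section_map G e), δₗ_naturality_right_assoc,
          ← MonoidalLeftAction.actionHomRight_comp,
          map_sectionLeftCoh, reassoc_of% (F.section_inv_hom G e)]
        simp
      δₗ_unitality_inv b := by
        apply F.functor.map_injective
        rw [← cancel_mono (F.leftCoh (𝟙_ C) (G.obj b))]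
        simp only [Functor.map_comp, Category.assoc, map_sectionLeftCoh,
          reassoc_of% (F.section_map G e),
          ← δₗ_unitality_inv]
        rw [MonoidalLeftAction.actionUnitIso_inv_naturality, reassoc_of% (F.section_hom_inv G e)]
        rfl }
  right :=
    { δᵣ b d := F.sectionRightCoh G e b d
      δᵣ_naturality_left {b b'} f d := by
        apply F.functor.map_injective
        rw [← cancel_mono (F.rightCoh (G.obj b') d)]
        simp only [Functor.map_comp, Category.assoc, map_sectionRightCoh,
          reassoc_of% (F.section_map G e),
          δᵣ_naturality_left, reassoc_of% (F.map_sectionRightCoh G e),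
          ← MonoidalRightAction.comp_actionHomLeft,
          section_map_inv]
      δᵣ_naturality_right b d d' f := by
        apply F.functor.map_injective
        rw [← cancel_mono (F.rightCoh (G.obj b) d')]
        simp only [Functor.map_comp, Category.assoc, map_sectionRightCoh,
          reassoc_of% (F.section_map G e),
          δᵣ_naturality_right, reassoc_of% (F.map_sectionRightCoh G e),
          MonoidalRightAction.action_exchange]
        rfl
      δᵣ_associativity b d d' := by
        apply F.functor.map_injective
        rw [← cancel_mono (F.rightCoh (G.obj b ⊙ᵣ d) d' ≫ F.rightCoh (G.obj b) d ⊵ᵣ d')]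
        simp only [Functor.map_comp, Category.assoc, ← δᵣ_associativity,
          reassoc_of% (F.map_sectionRightCoh G e),
          reassoc_of% (F.section_map G e), δᵣ_naturality_left_assoc,
          ← MonoidalRightAction.comp_actionHomLeft,
          map_sectionRightCoh, reassoc_of% (F.section_inv_hom G e)]
        simp
      δᵣ_unitality_inv b := by
        apply F.functor.map_injective
        rw [← cancel_mono (F.rightCoh (G.obj b) (𝟙_ D))]
        simp only [Functor.map_comp, Category.assoc, map_sectionRightCoh,
          reassoc_of% (F.section_map G e),
          ← δᵣ_unitality_inv]
        rw [MonoidalRightAction.actionUnitIso_inv_naturality, reassoc_of% (F.section_hom_inv G e)]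
        rfl }
  law_comp c b d := by
    apply F.functor.map_injective
    rw [← cancel_mono (F.rightCoh (c ⊙ₗ G.obj b) d ≫ F.leftCoh c (G.obj b) ⊵ᵣ d)]
    simp only [Functor.map_comp, Category.assoc, ← F.law_comp, δₗ_naturality_right_assoc,
      δᵣ_naturality_left_assoc, reassoc_of% (F.map_sectionLeftCoh G e),
      reassoc_of% (F.section_map G e),
      ← MonoidalLeftAction.actionHomRight_comp_assoc, ← MonoidalRightAction.comp_actionHomLeft,
      map_sectionLeftCoh, map_sectionRightCoh, reassoc_of% (F.map_sectionRightCoh G e),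
      reassoc_of% (F.section_inv_hom G e)]
    -- Both sides now begin with the same component of `e.hom`; what remains is `e.inv` passing
    -- through the law of `N`.
    exact congrArg (e.hom.app _ ≫ ·) (N.law.naturality_middle c (e.inv.app b) d)

/-- A strong biequivariant functor whose underlying functor is fully faithful and has a section up
to isomorphism is a biequivalence. -/
theorem nonempty_equivalence_of_section (F : ColaxBiequivariantFunctor M N)
    (G : N.carrier ⥤ M.carrier) (e : G ⋙ F.functor ≅ 𝟭 N.carrier)
    [F.functor.Full] [F.functor.Faithful]
    [∀ (c : C) a, IsIso (F.leftCoh c a)] [∀ a (d : D), IsIso (F.rightCoh a d)] :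
    Nonempty (Bicategory.Equivalence N M) := by
  let S := F.sectionFunctor G e
  let unit : ColaxBiequivariantFunctor.id N ≅ S.comp F := isoOfNatIso e.symm
    (fun c b => by
      change e.inv.app (c ⊙ₗ b) ≫ F.functor.map (F.sectionLeftCoh G e c b) ≫
        F.leftCoh c (G.obj b) = 𝟙 (c ⊙ₗ b) ≫ c ⊴ₗ e.inv.app b
      rw [map_sectionLeftCoh]
      exact (Category.assoc _ _ _).symm.trans (congrArg (· ≫ _) (F.section_inv_hom G e _)))
    (fun b d => by
      change e.inv.app (b ⊙ᵣ d) ≫ F.functor.map (F.sectionRightCoh G e b d) ≫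
        F.rightCoh (G.obj b) d = 𝟙 (b ⊙ᵣ d) ≫ e.inv.app b ⊵ᵣ d
      rw [map_sectionRightCoh]
      exact (Category.assoc _ _ _).symm.trans (congrArg (· ≫ _) (F.section_inv_hom G e _)))
  -- The counit is the lift of `e` at `F a` through the fully faithful `F`; its compatibilities are
  -- checked after applying `F`.
  let k (a : M.carrier) : G.obj (F.functor.obj a) ≅ a :=
    F.functor.preimageIso (e.app (F.functor.obj a))
  have hk (a : M.carrier) : F.functor.map (k a).hom = e.hom.app (F.functor.obj a) :=
    F.functor.map_preimage _
  have hkl (c : C) (a : M.carrier) : (k (c ⊙ₗ a)).hom =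
      (G.map (F.leftCoh c a) ≫ F.sectionLeftCoh G e c (F.functor.obj a)) ≫ c ⊴ₗ (k a).hom := by
    apply F.functor.map_injective
    rw [← cancel_mono (F.leftCoh c a)]
    simp only [Functor.map_comp, Category.assoc, δₗ_naturality_right,
      reassoc_of% (F.map_sectionLeftCoh G e),
      reassoc_of% (F.section_map G e), ← MonoidalLeftAction.actionHomRight_comp, hk,
      section_inv_hom]
    simp
  have hkr (a : M.carrier) (d : D) : (k (a ⊙ᵣ d)).hom =
      (G.map (F.rightCoh a d) ≫ F.sectionRightCoh G e (F.functor.obj a) d) ≫ (k a).hom ⊵ᵣ d := by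
    apply F.functor.map_injective
    rw [← cancel_mono (F.rightCoh a d)]
    simp only [Functor.map_comp, Category.assoc, δᵣ_naturality_left,
      reassoc_of% (F.map_sectionRightCoh G e),
      reassoc_of% (F.section_map G e), ← MonoidalRightAction.comp_actionHomLeft, hk,
      section_inv_hom]
    simp
  have hkn {a a' : M.carrier} (f : a ⟶ a') :
      G.map (F.functor.map f) ≫ (k a').hom = (k a).hom ≫ f := by
    apply F.functor.map_injective
    simpa only [Functor.map_comp, hk] using F.section_map G e _ _ (F.functor.map f)
  let counit : F.comp S ≅ ColaxBiequivariantFunctor.id M := isoOfNatIso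
    (NatIso.ofComponents k hkn)
    (fun c a => (Category.comp_id _).trans (hkl c a))
    (fun a d => (Category.comp_id _).trans (hkr a d))
  -- No triangle identity has been checked: the counit is corrected to satisfy it.
  exact ⟨Bicategory.Equivalence.mkOfAdjointifyCounit (f := (S : N ⟶ M)) (g := (F : M ⟶ N))
    unit counit⟩

end ColaxBiequivariantFunctor

end Equivalences

/-! ### The tensor product with the regular biactegory, and its projection. -/

namespace Biactegory

variable {C : Type u} [Category.{v} C] [MonoidalCategory C]
  {D : Type u} [Category.{v} D] [MonoidalCategory D] (M : Biactegory.{v, u} C D)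

instance (c : C) (a : M.carrier) (d : D) : IsIso (M.law.app c a d) := M.isIso_law c a d

/-- The inverse form of the left unit coherence; it identifies the path `(g, m) → (1 ⊗ g, m) → (1, g
▷ m)` with the inverse unit constraint. -/
theorem leftUnitor_inv_actionHomLeft {A : Type u} [Category.{v} A] [MonoidalLeftAction C A]
    (c : C) (a : A) :
    (λ_ c).inv ⊵ₗ a = (λₗ (c ⊙ₗ a)).inv ≫ (αₗ (𝟙_ C) c a).inv := by
  rw [← cancel_epi ((λ_ c).hom ⊵ₗ a), MonoidalLeftAction.hom_inv_actionHomLeft,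
    MonoidalLeftAction.leftUnitor_actionHom]
  simp

/-- The tensor product of the regular biactegory with `M`: its objects are the pairs `(g, m)`, and
the morphisms `(g, m) ⟶ (g', m')` are the morphisms `g ▷ m ⟶ g' ▷ m'` of `M`. -/
noncomputable def regularTensor : Biactegory.{v, u} C D :=
  inducedBiactegory M (P := C × M.carrier) (fun p => p.1 ⊙ₗ p.2)
    (fun c p => (c ⊗ p.1, p.2)) (fun c p => αₗ c p.1 p.2)
    -- The law of `M` is absorbed here, as the comparison for the right action. The new law is
    -- `Iso.refl`, and its compatibility is the left pentagon.
    (fun p d => (p.1, p.2 ⊙ᵣ d)) (fun p d => asIso (M.law.app p.1 p.2 d))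
    (fun _ _ _ => Iso.refl _)
    (fun c p d => by simpa using (M.law.left_pentagon c p.1 p.2 d).symm)

/-- The action of `C` on `M`, as a functor on the tensor product. -/
noncomputable def regularTensorAction : ColaxBiequivariantFunctor M.regularTensor M :=
  inducedBiequivariantFunctor M (P := C × M.carrier) (fun p => p.1 ⊙ₗ p.2)
    (fun c p => (c ⊗ p.1, p.2)) (fun c p => αₗ c p.1 p.2)
    (fun p d => (p.1, p.2 ⊙ᵣ d)) (fun p d => asIso (M.law.app p.1 p.2 d))
    (fun _ _ _ => Iso.refl _)
    (fun c p d => by simpa using (M.law.left_pentagon c p.1 p.2 d).symm)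

/-- Both bracketings are the pair `(c ⊗ g, m ◁ d)` by definition. -/
theorem regularTensor_hasIdentityLaw : M.regularTensor.HasIdentityLaw :=
  fun _ _ _ => ⟨rfl, rfl⟩

/-- The action functor is fully faithful because the morphisms of the tensor product are those of
`M`; its coherences are constraints and components of the law, hence invertible. -/
theorem nonempty_equivalence_regularTensor :
    Nonempty (Bicategory.Equivalence M M.regularTensor) := by
  let G : M.carrier ⥤ M.regularTensor.carrier :=
    { obj m := ((𝟙_ C, m) : C × M.carrier)
      map {m m'} f := InducedCategory.homMk (X := ((𝟙_ C, m) : C × M.carrier))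
        (Y := ((𝟙_ C, m') : C × M.carrier)) (𝟙_ C ⊴ₗ f)
      map_id m := InducedCategory.hom_ext (MonoidalLeftAction.actionHomRight_id _ _)
      map_comp f g := InducedCategory.hom_ext (MonoidalLeftAction.actionHomRight_comp _ _ _) }
  let e : G ⋙ M.regularTensorAction.functor ≅ 𝟭 M.carrier :=
    NatIso.ofComponents (fun m => λₗ[C] m)
      (fun f => (MonoidalLeftAction.actionUnitIso_hom_naturality f).symm)
  have : M.regularTensorAction.functor.Full := InducedCategory.full _
  have : M.regularTensorAction.functor.Faithful := InducedCategory.faithful _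
  have : ∀ (c : C) a, IsIso (M.regularTensorAction.leftCoh c a) :=
    fun c p => inferInstanceAs (IsIso (αₗ c p.1 p.2).hom)
  have : ∀ a (d : D), IsIso (M.regularTensorAction.rightCoh a d) :=
    fun p d => inferInstanceAs (IsIso (M.law.app p.1 p.2 d))
  exact M.regularTensorAction.nonempty_equivalence_of_section G e

/-- A morphism of the tensor product is a morphism of `M`. -/
def regularTensorHom {p q : C × M.carrier} (f : p.1 ⊙ₗ p.2 ⟶ q.1 ⊙ₗ q.2) :
    (show M.regularTensor.carrier from p) ⟶ (show M.regularTensor.carrier from q) :=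
  InducedCategory.homMk f

/-- The projection from the product to the tensor product: the identity on objects, the action on
morphisms. -/
noncomputable def regularTensorProj :
    ColaxBiequivariantFunctor (outer (regular C) M) M.regularTensor where
  functor :=
    { obj p := p
      map {p q} f := M.regularTensorHom (p := p) (q := q) (f.1 ⊙ₗₘ f.2)
      map_id p := InducedCategory.hom_ext (by
        change (𝟙 p.1 ⊙ₗₘ 𝟙 p.2) = 𝟙 (p.1 ⊙ₗ p.2)
        simp)
      map_comp f g := InducedCategory.hom_ext (MonoidalLeftAction.actionHom_comp _ _ _ _) }
  left :=
    letI : MonoidalLeftAction C (C × M.carrier) := prodLeftAction C M.carrier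
    { δₗ c p := M.regularTensorHom (p := (c ⊗ p.1, p.2)) (q := (c ⊗ p.1, p.2)) (𝟙 _)
      δₗ_naturality_left {c c'} f p := InducedCategory.hom_ext (by
        change (f ▷ p.1 ⊙ₗₘ 𝟙 p.2) ≫ 𝟙 _ = 𝟙 _ ≫ (αₗ c p.1 p.2).hom ≫ f ⊵ₗ (p.1 ⊙ₗ p.2) ≫
          (αₗ c' p.1 p.2).inv
        simp)
      δₗ_naturality_right c {p q} f := InducedCategory.hom_ext (by
        change (c ◁ f.1 ⊙ₗₘ f.2) ≫ 𝟙 _ = 𝟙 _ ≫ (αₗ c p.1 p.2).hom ≫ c ⊴ₗ (f.1 ⊙ₗₘ f.2) ≫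
          (αₗ c q.1 q.2).inv
        simp [MonoidalLeftAction.actionHom_def])
      δₗ_associativity c c' p := InducedCategory.hom_ext (by
        change 𝟙 _ ≫ (αₗ (c ⊗ c') p.1 p.2).hom ≫ (αₗ c c' (p.1 ⊙ₗ p.2)).hom ≫
          c ⊴ₗ (αₗ c' p.1 p.2).inv ≫ (αₗ c (c' ⊗ p.1) p.2).inv =
          ((α_ c c' p.1).hom ⊙ₗₘ 𝟙 p.2) ≫ 𝟙 _ ≫ ((αₗ c (c' ⊗ p.1) p.2).hom ≫ c ⊴ₗ (𝟙 _) ≫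
            (αₗ c (c' ⊗ p.1) p.2).inv)
        rw [Category.id_comp, ← MonoidalLeftAction.associator_actionHom_assoc]
        simp)
      δₗ_unitality_inv p := InducedCategory.hom_ext (by
        change (λₗ (p.1 ⊙ₗ p.2)).inv ≫ (αₗ (𝟙_ C) p.1 p.2).inv = ((λ_ p.1).inv ⊙ₗₘ 𝟙 p.2) ≫ 𝟙 _
        simp [leftUnitor_inv_actionHomLeft]) }
  right :=
    letI : MonoidalRightAction D (C × M.carrier) := prodRightAction C M.carrier
    -- With identity coherences, the axioms below amount to naturality, the right pentagon and the
    -- right triangle of the law of `M`.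
    { δᵣ p d := M.regularTensorHom (p := (p.1, p.2 ⊙ᵣ d)) (q := (p.1, p.2 ⊙ᵣ d)) (𝟙 _)
      δᵣ_naturality_left {p q} f d := InducedCategory.hom_ext (by
        change (f.1 ⊙ₗₘ f.2 ⊵ᵣ d) ≫ 𝟙 _ = 𝟙 _ ≫ M.law.app p.1 p.2 d ≫ (f.1 ⊙ₗₘ f.2) ⊵ᵣ d ≫
          inv (M.law.app q.1 q.2 d)
        rw [Category.comp_id, Category.id_comp, ← Category.assoc, IsIso.eq_comp_inv]
        simpa using M.law.naturality f.1 f.2 (𝟙 d))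
      δᵣ_naturality_right p {d d'} f := InducedCategory.hom_ext (by
        change (𝟙 p.1 ⊙ₗₘ p.2 ⊴ᵣ f) ≫ 𝟙 _ = 𝟙 _ ≫ M.law.app p.1 p.2 d ≫ (p.1 ⊙ₗ p.2) ⊴ᵣ f ≫
          inv (M.law.app p.1 p.2 d')
        rw [Category.comp_id, Category.id_comp, ← Category.assoc, IsIso.eq_comp_inv]
        simpa using M.law.naturality (𝟙 p.1) (𝟙 p.2) f)
      δᵣ_associativity p d d' := InducedCategory.hom_ext (by
        change 𝟙 _ ≫ M.law.app p.1 p.2 (d ⊗ d') ≫ (αᵣ (p.1 ⊙ₗ p.2) d d').hom ≫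
          inv (M.law.app p.1 p.2 d) ⊵ᵣ d' ≫ inv (M.law.app p.1 (p.2 ⊙ᵣ d) d') =
          (𝟙 p.1 ⊙ₗₘ (αᵣ p.2 d d').hom) ≫ 𝟙 _ ≫ (M.law.app p.1 (p.2 ⊙ᵣ d) d' ≫ (𝟙 _) ⊵ᵣ d' ≫
            inv (M.law.app p.1 (p.2 ⊙ᵣ d) d'))
        have h := M.law.right_pentagon p.1 p.2 d d'
        rw [Category.id_comp, ← reassoc_of% h]
        simp [← MonoidalRightAction.comp_actionHomLeft_assoc])
      δᵣ_unitality_inv p := InducedCategory.hom_ext (by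
        change (ρᵣ (p.1 ⊙ₗ p.2)).inv ≫
          inv (M.law.app p.1 p.2 (𝟙_ D)) = (𝟙 p.1 ⊙ₗₘ (ρᵣ p.2).inv) ≫ 𝟙 _
        have h := M.law.right_triangle p.1 p.2
        rw [← cancel_epi (M.law.app p.1 p.2 (𝟙_ D) ≫ (ρᵣ (p.1 ⊙ₗ p.2)).hom), Category.assoc,
          Iso.hom_inv_id_assoc, h]
        simp) }
  law_comp c p d := InducedCategory.hom_ext (by
    change 𝟙 _ ≫ ((αₗ c p.1 (p.2 ⊙ᵣ d)).hom ≫ c ⊴ₗ 𝟙 _ ≫ (αₗ c p.1 (p.2 ⊙ᵣ d)).inv) ≫ 𝟙 _ =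
      (𝟙 (c ⊗ p.1) ⊙ₗₘ 𝟙 (p.2 ⊙ᵣ d)) ≫ 𝟙 _ ≫
        (M.law.app (c ⊗ p.1) p.2 d ≫ (𝟙 _) ⊵ᵣ d ≫ inv (M.law.app (c ⊗ p.1) p.2 d))
    simp)

/-! ### The balancing and the generation of morphisms. -/

/-- The balancing of the projection, given by the associativity constraint of the action. -/
noncomputable def regularTensorBalancing :
    Balancing C (A := C) (B := M.carrier) M.regularTensorProj.functor where
  iso a x b := InducedCategory.isoMk (F := fun p : C × M.carrier => p.1 ⊙ₗ p.2)
    (X := ((a ⊗ x, b) : C × M.carrier)) (Y := ((a, x ⊙ₗ b) : C × M.carrier)) (αₗ a x b)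
  naturality f g h := InducedCategory.hom_ext
    (MonoidalLeftAction.actionAssocIso_hom_naturality f g h)
  associativity a x y b := InducedCategory.hom_ext (by
    change (αₗ a (x ⊗ y) b).hom ≫ (𝟙 a ⊙ₗₘ (αₗ x y b).hom) =
      -- The inverse appears because the right associativity constraint of the regular biactegory is
      -- `(α_ a x y).inv`; the identity is the pentagon of the action.
      ((α_ a x y).inv ⊙ₗₘ 𝟙 b) ≫ (αₗ (a ⊗ x) y b).hom ≫ (αₗ a x (y ⊙ₗ b)).hom
    rw [MonoidalLeftAction.actionHom_id, MonoidalLeftAction.id_actionHom,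
      ← MonoidalLeftAction.associator_actionHom, MonoidalLeftAction.inv_hom_actionHomLeft_assoc])
  unitality a b := InducedCategory.hom_ext (by
    change (αₗ a (𝟙_ C) b).hom ≫ (𝟙 a ⊙ₗₘ (λₗ b).hom) = ((ρ_ a).hom ⊙ₗₘ 𝟙 b)
    simp)

/-- The projection to the tensor product, as a balanced functor. -/
noncomputable def regularTensorBalanced : BalancedFunctor C C M.carrier M.regularTensor.carrier :=
  ⟨M.regularTensorProj.functor, M.regularTensorBalancing⟩

/-- Each morphism of the tensor product is a composite of morphisms in the image of the projection
and components of the balancing. -/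
theorem regularTensor_hom_eq {p q : C × M.carrier} (f : p.1 ⊙ₗ p.2 ⟶ q.1 ⊙ₗ q.2) :
    M.regularTensorHom f =
      M.regularTensorProj.functor.map (((λ_ p.1).inv, 𝟙 p.2) : p ⟶ (𝟙_ C ⊗ p.1, p.2)) ≫
        (M.regularTensorBalancing.iso (𝟙_ C) p.1 p.2).hom ≫
        M.regularTensorProj.functor.map
          ((𝟙 (𝟙_ C), f) : ((𝟙_ C, p.1 ⊙ₗ p.2) : C × M.carrier) ⟶ (𝟙_ C, q.1 ⊙ₗ q.2)) ≫
        (M.regularTensorBalancing.iso (𝟙_ C) q.1 q.2).inv ≫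
        M.regularTensorProj.functor.map (((λ_ q.1).hom, 𝟙 q.2) : (𝟙_ C ⊗ q.1, q.2) ⟶ q) :=
  -- The outer factors compose to the unit constraint of `M` and its inverse, so this is its
  -- naturality at `f`.
  InducedCategory.hom_ext (by
    change f = ((λ_ p.1).inv ⊙ₗₘ 𝟙 p.2) ≫ (αₗ (𝟙_ C) p.1 p.2).hom ≫ (𝟙 (𝟙_ C) ⊙ₗₘ f) ≫
      (αₗ (𝟙_ C) q.1 q.2).inv ≫ ((λ_ q.1).hom ⊙ₗₘ 𝟙 q.2)
    simp [leftUnitor_inv_actionHomLeft])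

/-- A family of morphisms between two functors on the tensor product is natural as soon as it is
natural on the image of the projection and on the balancing. -/
theorem regularTensor_naturality {X : Type u} [Category.{v} X] {H H' : M.regularTensor.carrier ⥤ X}
    (t : ∀ p, H.obj p ⟶ H'.obj p)
    (hproj : ∀ {p q : C × M.carrier} (f : p ⟶ q), H.map (M.regularTensorProj.functor.map f) ≫ t q =
      t p ≫ H'.map (M.regularTensorProj.functor.map f))
    (hbal : ∀ (a x : C) (b : M.carrier), H.map (M.regularTensorBalancing.iso a x b).hom ≫
      t ((a, x ⊙ₗ b) : C × M.carrier) =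
      t ((a ⊗ x, b) : C × M.carrier) ≫ H'.map (M.regularTensorBalancing.iso a x b).hom)
    {p q : M.regularTensor.carrier} (f : p ⟶ q) : H.map f ≫ t q = t p ≫ H'.map f := by
  -- Morphisms satisfying the naturality square are closed under composition and inversion of
  -- isomorphisms, so the generators suffice.
  let natural {p q : M.regularTensor.carrier} (f : p ⟶ q) : Prop :=
    H.map f ≫ t q = t p ≫ H'.map f
  have hcomp {p q r : M.regularTensor.carrier} {f : p ⟶ q} {g : q ⟶ r} (hf : natural f)
      (hg : natural g) : natural (f ≫ g) := by
    dsimp only [natural] at hf hg ⊢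
    rw [H.map_comp, H'.map_comp, Category.assoc, hg, reassoc_of% hf]
  have hinv {p q : M.regularTensor.carrier} (i : p ≅ q) (hi : natural i.hom) :
      natural i.inv := by
    dsimp only [natural] at hi ⊢
    rw [← cancel_epi (H.map i.hom), reassoc_of% hi, ← H.map_comp_assoc, ← H'.map_comp]
    simp
  have h := M.regularTensor_hom_eq (p := p) (q := q) (M.regularTensorAction.functor.map f)
  exact (show f = _ from h) ▸ hcomp (hproj _) (hcomp (hbal _ _ _) (hcomp (hproj _)
    (hcomp (hinv _ (hbal _ _ _)) (hproj _))))

/-! ### Extension of balanced functors to the tensor product. -/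

section Lift

variable {M} {X : Type u} [Category.{v} X] (K : BalancedFunctor C C M.carrier X)

/-- The isomorphism `F (g, m) ≅ F (1, g ▷ m)` of a balanced functor on `C × M`. -/
def balancedUnitIso (p : C × M.carrier) : K.functor.obj p ≅ K.functor.obj (𝟙_ C, p.1 ⊙ₗ p.2) :=
  K.functor.mapIso (Iso.prod (λ_ p.1).symm (Iso.refl p.2)) ≪≫ K.bal.iso (𝟙_ C) p.1 p.2

/-- Combines naturality of the unitor with that of the balancing at `𝟙_ C`; it makes the lift
restrict to `K` on morphisms. -/
theorem balancedUnitIso_hom_naturality {p q : C × M.carrier} (f : p ⟶ q) :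
    K.functor.map f ≫ (balancedUnitIso K q).hom = (balancedUnitIso K p).hom ≫
      K.functor.map ((𝟙 _, f.1 ⊙ₗₘ f.2) :
        ((𝟙_ C, p.1 ⊙ₗ p.2) : C × M.carrier) ⟶ (𝟙_ C, q.1 ⊙ₗ q.2)) := by
  have h := K.bal.naturality (𝟙 (𝟙_ C)) f.1 f.2
  simp only [balancedUnitIso, Iso.trans_hom, Functor.mapIso_hom, Category.assoc]
  erw [← h, ← K.functor.map_comp_assoc, ← K.functor.map_comp_assoc]
  congr 2
  apply Prod.ext
  · simp
  · simp

/-- Associativity of the balancing at `(𝟙_ C, a, x)`, moved along `(λ_ a).inv` by naturality; it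
makes the lift carry the balancing of the projection to that of `K`. -/
theorem balancedUnitIso_hom_assoc_balancing (a x : C) (b : M.carrier) :
    (balancedUnitIso K (a ⊗ x, b)).hom ≫ K.functor.map ((𝟙 _, (αₗ a x b).hom) :
        ((𝟙_ C, (a ⊗ x) ⊙ₗ b) : C × M.carrier) ⟶ (𝟙_ C, a ⊙ₗ x ⊙ₗ b)) =
      (K.bal.iso a x b).hom ≫ (balancedUnitIso K (a, x ⊙ₗ b)).hom := by
  have h := K.bal.naturality (λ_ a).inv (𝟙 x) (𝟙 b)
  have h' := K.bal.associativity (𝟙_ C) a x b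
  have e : K.functor.map (((λ_ (a ⊗ x)).inv, 𝟙 b) : (a ⊗ x, b) ⟶ (𝟙_ C ⊗ a ⊗ x, b)) ≫
      K.functor.map (((α_ (𝟙_ C) a x).inv, 𝟙 b) : (𝟙_ C ⊗ a ⊗ x, b) ⟶ ((𝟙_ C ⊗ a) ⊗ x, b)) =
      K.functor.map (((λ_ a).inv ⊗ₘ 𝟙 x, 𝟙 b) : (a ⊗ x, b) ⟶ ((𝟙_ C ⊗ a) ⊗ x, b)) := by
    rw [← K.functor.map_comp]
    congr 1
    apply Prod.ext
    · simp
    · simp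
  have e' : K.functor.map (((λ_ a).inv, 𝟙 x ⊙ₗₘ 𝟙 b) : (a, x ⊙ₗ b) ⟶ (𝟙_ C ⊗ a, x ⊙ₗ b)) =
      K.functor.map (((λ_ a).inv, 𝟙 (x ⊙ₗ b)) : (a, x ⊙ₗ b) ⟶ (𝟙_ C ⊗ a, x ⊙ₗ b)) := by simp
  rw [e'] at h
  replace h := h =≫ (K.bal.iso (𝟙_ C) a (x ⊙ₗ b)).hom
  replace e := e =≫ ((K.bal.iso (𝟙_ C ⊗ a) x b).hom ≫ (K.bal.iso (𝟙_ C) a (x ⊙ₗ b)).hom)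
  rw [Category.assoc] at h e
  change (_ ≫ _) ≫ _ = _ ≫ _ ≫ _
  rw [Category.assoc]
  exact (congrArg (_ ≫ ·) h').trans (e.trans (h.trans (Category.assoc _ _ _)))

/-- The functor on the tensor product induced by a balanced functor. -/
noncomputable def regularTensorLift : M.regularTensor.carrier ⥤ X where
  obj p := K.functor.obj p
  -- The only possible value, by `regularTensor_hom_eq`.
  map {p q} f := (balancedUnitIso K p).hom ≫
    K.functor.map ((𝟙 _, M.regularTensorAction.functor.map f) :
      ((𝟙_ C, p.1 ⊙ₗ p.2) : C × M.carrier) ⟶ (𝟙_ C, q.1 ⊙ₗ q.2)) ≫ (balancedUnitIso K q).inv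
  map_id p := by
    rw [M.regularTensorAction.functor.map_id, Iso.hom_comp_eq_id]
    exact (congrArg (· ≫ _) (K.functor.map_id _)).trans (Category.id_comp _)
  map_comp {p q r} f g := by
    simp only [Category.assoc, Iso.inv_hom_id_assoc]
    rw [← K.functor.map_comp_assoc, M.regularTensorAction.functor.map_comp,
      prod_comp, Category.comp_id]
    rfl

end Lift

/-- Heterogeneous equality is needed because the balancing isomorphisms live over the functor; once
the functors are identified, their forward morphisms determine everything. -/
theorem _root_.BalancedFunctor.mk_eq_mk {A B X : Type u} [Category.{v} A] [Category.{v} B]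
    [Category.{v} X] [MonoidalRightAction C A] [MonoidalLeftAction C B] {F F' : A × B ⥤ X}
    (hF : F = F') (b : Balancing C F) (b' : Balancing C F')
    (h : ∀ a x c, HEq (b.iso a x c).hom (b'.iso a x c).hom) :
    BalancedFunctor.mk F b = BalancedFunctor.mk F' b' := by
  subst hF
  obtain ⟨i, _, _, _⟩ := b
  obtain ⟨i', _, _, _⟩ := b'
  obtain rfl : i = i' := by
    ext a x c
    exact eq_of_heq (h a x c)
  rfl

theorem regularTensor_isPseudocoequalizer : M.regularTensorBalanced.IsPseudocoequalizer := by
  intro X _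
  refine ⟨⟨?_, ?_⟩, ?_, ?_⟩
  -- Uniqueness: applying `H` to the decomposition of `f` gives the lift formula.
  · suffices h : Function.LeftInverse regularTensorLift (M.regularTensorBalanced.comparison X).obj
      from h.injective
    intro H
    refine CategoryTheory.Functor.hext (fun _ => rfl) fun p q f => heq_of_eq ?_
    have h := M.regularTensor_hom_eq (p := p) (q := q) (M.regularTensorAction.functor.map f)
    have hmap {p q r s t z : M.regularTensor.carrier} (f : p ⟶ q) (g : q ⟶ r) (h : r ⟶ s)
        (k : s ⟶ t) (l : t ⟶ z) : H.map (f ≫ g ≫ h ≫ k ≫ l) =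
          H.map f ≫ H.map g ≫ H.map h ≫ H.map k ≫ H.map l := by
      simp only [H.map_comp]
    exact (Category.assoc _ _ _).trans ((congrArg H.map h).trans (hmap _ _ _ _ _)).symm
  · suffices h : Function.RightInverse regularTensorLift (M.regularTensorBalanced.comparison X).obj
      from h.surjective
    intro K
    change BalancedFunctor.mk _ _ = BalancedFunctor.mk K.functor K.bal
    refine BalancedFunctor.mk_eq_mk ?_ _ _ fun a x b => heq_of_eq ?_
    · refine CategoryTheory.Functor.hext (fun _ => rfl) fun p q f => heq_of_eq ?_
      exact (Category.assoc _ _ _).symm.trans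
        ((Iso.comp_inv_eq _).2 (balancedUnitIso_hom_naturality K f).symm)
    · have h := balancedUnitIso_hom_assoc_balancing K a x b =≫
        (balancedUnitIso K (a, x ⊙ₗ b)).inv
      rw [Category.assoc, Category.assoc, Iso.hom_inv_id, Category.comp_id] at h
      exact h
  · constructor
    intro H H' θ
    -- The projection is the identity on objects, so the components are already given; only
    -- naturality on the new morphisms is needed.
    refine ⟨{ app p := θ.natTrans.app p, naturality p q f := ?_}, rfl⟩
    exact M.regularTensor_naturality θ.natTrans.app (fun f => θ.natTrans.naturality f)
      (fun a x b => (θ.comm a x b).symm) f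
  · constructor
    intro H H' θ θ' h
    ext p
    exact congr_arg (fun t => (BalancedFunctor.Hom.natTrans t).app p) h

/-- The tensor product of the regular biactegory with `M`. -/
noncomputable def regularTensorProduct : TensorProduct (regular C) M where
  vertex := M.regularTensor
  proj := M.regularTensorProj
  proj_left c p := ⟨rfl, rfl⟩
  proj_right p d := ⟨rfl, rfl⟩
  bal := M.regularTensorBalancing
  isPseudocoequalizer := M.regularTensor_isPseudocoequalizer
  -- The law of the regular biactegory is an inverse associator, so this is the pentagon of the
  -- action on `M`.
  bal_left c m d n := InducedCategory.hom_ext (by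
    change 𝟙 _ ≫ ((αₗ c (m ⊗ d) n).hom ≫ c ⊴ₗ (αₗ m d n).hom ≫ (αₗ c m (d ⊙ₗ n)).inv) =
      ((α_ c m d).inv ⊙ₗₘ 𝟙 n) ≫ (αₗ (c ⊗ m) d n).hom ≫ 𝟙 _
    rw [← cancel_mono (αₗ c m (d ⊙ₗ n)).hom, Category.comp_id, Category.assoc (_ ⊙ₗₘ _),
      ← MonoidalLeftAction.associator_actionHom, MonoidalLeftAction.actionHom_id,
      MonoidalLeftAction.inv_hom_actionHomLeft_assoc]
    simp)
  bal_right m d n e := InducedCategory.hom_ext (by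
    change 𝟙 _ ≫ (M.law.app (m ⊗ d) n e ≫ (αₗ m d n).hom ⊵ᵣ e ≫ inv (M.law.app m (d ⊙ₗ n) e)) =
      (αₗ m d (n ⊙ᵣ e)).hom ≫ (𝟙 m ⊙ₗₘ M.law.app d n e) ≫ 𝟙 _
    -- Here the outer right action is compared through the law of `M`, so its left pentagon is what
    -- is required.
    have h := M.law.left_pentagon m d n e
    rw [Category.id_comp, ← reassoc_of% h]
    simp)

end Biactegory

theorem mainTheorem12 {G : Type u} [Category.{v} G] [MonoidalCategory G]
    {G' : Type u} [Category.{v} G'] [MonoidalCategory G'] (M : Biactegory.{v, u} G G') :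
    ∃ T : Biactegory.TensorProduct (Biactegory.regular G) M,
      T.vertex.HasIdentityLaw ∧ Nonempty (Bicategory.Equivalence M T.vertex) :=
  ⟨M.regularTensorProduct, M.regularTensor_hasIdentityLaw, M.nonempty_equivalence_regularTensor⟩
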